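/- Let $E$ be a complex Banach space and let $D$ be the infinitesimal generator of a strongly continuous one-parameter group $(e^{tD})_{t\in\mathbb R}$ of bounded operators on $E$ which is bounded, i.e. $\sup_{t\in\mathbb R}\|e^{tD}\|<\infty$. Powers $D^k$ are taken on their natural domains. For $\sigma\ge 0$ let $\mathbf E_\sigma(D)$ be the set of all $f\in\bigcap_k\operatorname{dom}(D^k)$ for which there is a constant $C(f)>0$ with $\|D^kf\|\le C(f)\,\sigma^k$ for all $k$, and let $\mathbf B_\sigma(D)$ be the set of all $f\in\bigcap_k\operatorname{dom}(D^k)$ with $\|D^kf\|\le\sigma^k\|f\|$ for all $k$. For $m\ge 1$ put $$A_{m,k}=\frac{(2m-1)!}{\pi(k-\frac12)^{2m}}\sum_{j=0}^{m-1}\frac{(-1)^j}{(2j)!}\Bigl(\pi\bigl(k-\tfrac12\bigr)\Bigr)^{2j}\quad(k\in\mathbb Z),$$ $$B_{m,k}=\frac{(2m)!}{\pi k^{2m+1}}\sum_{j=0}^{m-1}\frac{(-1)^j(\pi k)^{2j+1}}{(2j+1)!}\quad(k\in\mathbb Z\setminus\{0\}),\qquad B_{m,0}=(-1)^{m+1}\frac{\pi^{2m}}{2m+1},$$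 and for $\sigma>0$, $g\in E$ put $$\mathcal B_D^{(2m-1)}(\sigma)g=\Bigl(\frac\sigma\pi\Bigr)^{2m-1}\sum_{k\in\mathbb Z}(-1)^{k+1}A_{m,k}\,e^{\frac\pi\sigma(k-\frac12)D}g,\qquad \mathcal B_D^{(2m)}(\sigma)g=\Bigl(\frac\sigma\pi\Bigr)^{2m}\sum_{k\in\mathbb Z}(-1)^{k+1}B_{m,k}\,e^{\frac{\pi k}\sigma D}g .$$ Let $\sigma>0$. Then these series converge absolutely for every $g\in E$ and define bounded linear operators $\mathcal B_D^{(r)}(\sigma)$ on $E$, $r\ge 1$, and for every $f\in E$ the following conditions are equivalent: 1. $f\in\mathbf E_\sigma(D)$; 2. $t\mapsto e^{tD}f$ extends to an entire function $F:\mathbb C\to E$ of exponential type $\sigma$ (that is, for every $\varepsilon>0$ there is $C$ with $\|F(z)\|\le Ce^{(\sigma+\varepsilon)|z|}$ for all $z\in\mathbb C$) which is bounded on the real line; 3. for every integer $r\ge1$, $f\in\operatorname{dom}(D^r)$ and $D^rf=\mathcal B_D^{(r)}(\sigma)f$; 4. for every $r\ge1$, $f\in\operatorname{dom}(D^r)$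 and for all $t\in\mathbb R$ the sampling formula holds, with an unconditionally convergent series, namely $$e^{tD}D^{2m-1}f=\Bigl(\frac\sigma\pi\Bigr)^{2m-1}\sum_{k\in\mathbb Z}(-1)^{k+1}A_{m,k}\,e^{(t+\frac\pi\sigma(k-\frac12))D}f\quad\text{if } r=2m-1,$$ $$e^{tD}D^{2m}f=\Bigl(\frac\sigma\pi\Bigr)^{2m}\sum_{k\in\mathbb Z}(-1)^{k+1}B_{m,k}\,e^{(t+\frac{\pi k}\sigma)D}f\quad\text{if } r=2m.$$ If moreover every $e^{tD}$ is an isometry, then for every $f\in E$ the condition $f\in\mathbf B_\sigma(D)$ is equivalent to each of 2, 3 and 4. -/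

import Mathlib

open Filter Topology

noncomputable section

namespace Boas

variable {E : Type*} [NormedAddCommGroup E] [NormedSpace ℂ E]

/-- A strongly continuous one-parameter group `t ↦ U t` (`= e^{tD}`) of bounded operators. -/
structure IsC0Group (U : ℝ → E →L[ℂ] E) : Prop where
  map_zero : U 0 = ContinuousLinearMap.id ℂ E
  map_add : ∀ s t : ℝ, U (s + t) = (U s).comp (U t)
  continuous_orbit : ∀ g : E, Continuous fun t : ℝ => U t g

/-- `y = lim_{t → 0} (U t x - x) / t`. -/
def IsGeneratorValue (U : ℝ → E →L[ℂ] E) (x y : E) : Prop :=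
  Tendsto (fun t : ℝ => t⁻¹ • (U t x - x)) (𝓝[≠] 0) (𝓝 y)

theorem IsGeneratorValue.add {U : ℝ → E →L[ℂ] E} {x₁ y₁ x₂ y₂ : E}
    (h₁ : IsGeneratorValue U x₁ y₁) (h₂ : IsGeneratorValue U x₂ y₂) :
    IsGeneratorValue U (x₁ + x₂) (y₁ + y₂) := by
  unfold IsGeneratorValue at *
  refine (h₁.add h₂).congr fun t => ?_
  rw [← smul_add, map_add]
  congr 1
  abel

theorem IsGeneratorValue.smul {U : ℝ → E →L[ℂ] E} {x y : E} (c : ℂ)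
    (h : IsGeneratorValue U x y) : IsGeneratorValue U (c • x) (c • y) := by
  unfold IsGeneratorValue at *
  refine (h.const_smul c).congr fun t => ?_
  rw [smul_comm, map_smul, smul_sub]

theorem IsGeneratorValue.zero (U : ℝ → E →L[ℂ] E) : IsGeneratorValue U 0 0 := by
  simp [IsGeneratorValue]

theorem IsGeneratorValue.unique {U : ℝ → E →L[ℂ] E} {x y z : E}
    (h₁ : IsGeneratorValue U x y) (h₂ : IsGeneratorValue U x z) : y = z :=
  tendsto_nhds_unique h₁ h₂

/-- The infinitesimal generator `D` of `U`, an unbounded operator whose domain is the set of all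
`x` for which the limit of `(U t x - x) / t` as `t → 0` exists. -/
def generator (U : ℝ → E →L[ℂ] E) : E →ₗ.[ℂ] E where
  domain :=
    { carrier := {x | ∃ y, IsGeneratorValue U x y}
      add_mem' := fun ⟨_, h₁⟩ ⟨_, h₂⟩ => ⟨_, h₁.add h₂⟩
      zero_mem' := ⟨0, IsGeneratorValue.zero U⟩
      smul_mem' := fun c _ ⟨_, h⟩ => ⟨_, h.smul c⟩ }
  toFun :=
    { toFun := fun x => Classical.choose x.2
      map_add' := fun x₁ x₂ => (Classical.choose_spec (x₁ + x₂).2).unique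
        ((Classical.choose_spec x₁.2).add (Classical.choose_spec x₂.2))
      map_smul' := fun c x => (Classical.choose_spec (c • x).2).unique
        ((Classical.choose_spec x.2).smul c) }

/-- The power `D ^ k` of an unbounded operator: the domain of `D ^ (k + 1)` consists of all `x`
in the domain of `D ^ k` such that `D ^ k x` lies in the domain of `D`. -/
def opPow (D : E →ₗ.[ℂ] E) : ℕ → (E →ₗ.[ℂ] E)
  | 0 => LinearMap.toPMap LinearMap.id ⊤
  | k + 1 =>
    D.comp ((opPow D k).domRestrict
      ((D.domain.comap (opPow D k).toFun).map (opPow D k).domain.subtype)) (by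
        rintro ⟨x, hx₁, hx₂⟩
        obtain ⟨y, hy, rfl⟩ := Submodule.mem_map.1 hx₁
        exact hy)

/-- The Bernstein subspace `B_σ(D)`. -/
def bernsteinSpace (D : E →ₗ.[ℂ] E) (σ : ℝ) : Set E :=
  {f | ∀ k : ℕ, ∃ h : f ∈ (opPow D k).domain, ‖opPow D k ⟨f, h⟩‖ ≤ σ ^ k * ‖f‖}

/-- The space `E_σ(D)` of exponential vectors. -/
def exponentialSpace (D : E →ₗ.[ℂ] E) (σ : ℝ) : Set E :=
  {f | ∃ C : ℝ, 0 < C ∧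
    ∀ k : ℕ, ∃ h : f ∈ (opPow D k).domain, ‖opPow D k ⟨f, h⟩‖ ≤ C * σ ^ k}

/-- `F : ℂ → E` is an entire function of exponential type (at most) `σ`. -/
def IsEntireOfExpType (σ : ℝ) (F : ℂ → E) : Prop :=
  Differentiable ℂ F ∧
    ∀ ε : ℝ, 0 < ε → ∃ C : ℝ, ∀ z : ℂ, ‖F z‖ ≤ C * Real.exp ((σ + ε) * ‖z‖)

/-- The orbit `t ↦ U t f` extends to an entire `E`-valued function of exponential type `σ` which
is bounded on the real line. -/
def OrbitExtends (U : ℝ → E →L[ℂ] E) (σ : ℝ) (f : E) : Prop :=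
  ∃ F : ℂ → E, IsEntireOfExpType σ F ∧ (∀ t : ℝ, F (t : ℂ) = U t f) ∧
    ∃ K : ℝ, ∀ t : ℝ, ‖F (t : ℂ)‖ ≤ K

/-- The coefficients `A_{m,k}`, `m ≥ 1`. -/
def coeffA (m : ℕ) (k : ℤ) : ℝ :=
  ((2 * m - 1).factorial : ℝ) / (Real.pi * ((k : ℝ) - 1 / 2) ^ (2 * m)) *
    ∑ j ∈ Finset.range m,
      (-1 : ℝ) ^ j / ((2 * j).factorial : ℝ) * (Real.pi * ((k : ℝ) - 1 / 2)) ^ (2 * j)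

/-- The coefficients `B_{m,k}`, `m ≥ 1`. -/
def coeffB (m : ℕ) (k : ℤ) : ℝ :=
  if k = 0 then (-1 : ℝ) ^ (m + 1) * (Real.pi ^ (2 * m) / (2 * (m : ℝ) + 1))
  else ((2 * m).factorial : ℝ) / (Real.pi * (k : ℝ) ^ (2 * m + 1)) *
    ∑ j ∈ Finset.range m,
      (-1 : ℝ) ^ j * (Real.pi * (k : ℝ)) ^ (2 * j + 1) / ((2 * j + 1).factorial : ℝ)

/-- The `k`-th weight of the formula of order `r`: `(σ/π)^r (-1)^(k+1) A_{m,k}` if `r = 2m - 1`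
and `(σ/π)^r (-1)^(k+1) B_{m,k}` if `r = 2m`. -/
def weight (σ : ℝ) (r : ℕ) (k : ℤ) : ℝ :=
  (σ / Real.pi) ^ r * ((-1 : ℝ) ^ (k + 1) *
    if Odd r then coeffA ((r + 1) / 2) k else coeffB (r / 2) k)

/-- The `k`-th node of the formula of order `r`: `(π/σ)(k - 1/2)` if `r` is odd and `πk/σ` if `r`
is even. -/
def node (σ : ℝ) (r : ℕ) (k : ℤ) : ℝ :=
  if Odd r then Real.pi / σ * ((k : ℝ) - 1 / 2) else Real.pi * (k : ℝ) / σ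

/-- The operator `𝓑_D^{(r)}(σ)`, as a series of translates along the group. -/
def boasOp (U : ℝ → E →L[ℂ] E) (σ : ℝ) (r : ℕ) (f : E) : E :=
  ∑' k : ℤ, weight σ r k • U (node σ r k) f

/-- The Boas formulas `D^r f = 𝓑_D^{(r)}(σ) f`, `r = 1, 2, …`. -/
def BoasFormulas (U : ℝ → E →L[ℂ] E) (D : E →ₗ.[ℂ] E) (σ : ℝ) (f : E) : Prop :=
  ∀ r : ℕ, 1 ≤ r → ∃ h : f ∈ (opPow D r).domain, opPow D r ⟨f, h⟩ = boasOp U σ r f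

/-- The sampling formulas: `e^{tD} D^r f` is the sum of the weights times `e^{(t + node) D} f`,
for `r = 1, 2, …` and all real `t`. -/
def SamplingFormulas (U : ℝ → E →L[ℂ] E) (D : E →ₗ.[ℂ] E) (σ : ℝ) (f : E) : Prop :=
  ∀ r : ℕ, 1 ≤ r → ∃ h : f ∈ (opPow D r).domain, ∀ t : ℝ,
    HasSum (fun k : ℤ => weight σ r k • U (t + node σ r k) f) (U t (opPow D r ⟨f, h⟩))

end Boas

end

noncomputable section

namespace Boas

variable {E : Type*} [NormedAddCommGroup E] [NormedSpace ℂ E]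

/-! The equivalences run in the cycle 1 → 2 → 4 → 3 → 1. If `‖D^k f‖ ≤ C σ^k`, then `∑ z^k D^k f /
k!` is entire of type `σ`, and Taylor's formula identifies it with the orbit on the real line. In
the other direction, `‖D^r f‖` is bounded through the total mass of the weights. So everything rests
on the sampling formula and on that mass being exactly `σ^r`.

Sampling formula (`tendsto_sum_residues`): scale to `σ = 1`, where Phragmén–Lindelöf gives `‖F z‖ ≤
K exp |Im z|`. Let `c` be the cosine (`r` odd) or the sine (`r` even) and `P` its Taylor polynomial
of degree `r - 1`. Integrate `F P / (z^(r+1) c)` over growing circles on which `|c|` is at least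
`exp |Im z| / 4`. The integrals tend to `0`, and the residues are `F^(r)(0) / r!` and the weighted
samples at the zeros of `c`.

Total mass (`hasSum_abs_weight_one`): Taylor remainders of cosine and sine have constant sign on
each half-line, so the weights alternate in sign. Testing the formula on `e^{iz}`, up to a factor
`i`, sums their absolute values. For isometries this loses no constant, which gives the Bernstein
space. -/

/-! ### Residues at simple poles -/

open Metric in
/-- The residue theorem on a disc, for finitely many simple poles. -/
theorem circleIntegral_eq_sum_of_simple_poles [CompleteSpace E] {R : ℝ} (hR : 0 < R)
    (ρ : ℂ → E) (S : Finset ℂ) (hS : ∀ s ∈ S, s ∈ ball (0 : ℂ) R) (g : ℂ → E)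
    (hg : ∀ z ∈ closedBall (0 : ℂ) R, z ∉ S → DifferentiableAt ℂ g z)
    (hρ : ∀ s ∈ S, Tendsto (fun z => (z - s) • g z) (𝓝[≠] s) (𝓝 (ρ s))) :
    (∮ z in C(0, R), g z) = (2 * Real.pi * Complex.I : ℂ) • ∑ s ∈ S, ρ s := by
  classical
  induction S using Finset.induction_on generalizing g with
  | empty =>
    have : DiffContOnCl ℂ g (ball 0 R) := by
      refine DifferentiableOn.diffContOnCl fun z hz => ?_
      rw [closure_ball _ hR.ne'] at hz
      exact (hg z hz (by simp)).differentiableWithinAt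
    simpa using this.circleIntegral_eq_zero hR.le
  | insert s S hsS ih =>
    have hsR := hS s (by simp)
    have hsph : ∀ z ∈ sphere (0 : ℂ) R, z ∉ insert s S := fun z hz hz' => by
      have h1 := hS z hz'
      rw [mem_sphere] at hz
      rw [mem_ball] at h1
      exact h1.ne hz
    -- Subtract the principal part at `s`. What remains is `o(1 / (z - s))`, so Riemann's theorem
    -- removes the singularity and induction applies to the extension `g₂`.
    set g₁ : ℂ → E := fun z => g z - (z - s)⁻¹ • ρ s with hg₁
    have hd₁ : ∀ z ∈ closedBall (0 : ℂ) R, z ∉ insert s S → DifferentiableAt ℂ g₁ z := by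
      intro z hz hzS
      have hzs : z - s ≠ 0 := sub_ne_zero.2 fun h => hzS (by simp [h])
      exact (hg z hz hzS).sub (((differentiableAt_id.sub_const s).inv hzs).smul_const _)
    set g₂ : ℂ → E := Function.update g₁ s (limUnder (𝓝[≠] s) g₁) with hg₂
    have hne : ∀ z, z ≠ s → g₂ =ᶠ[𝓝 z] g₁ := fun z hz => by
      filter_upwards [isOpen_ne.mem_nhds hz] with w hw
      simp [hg₂, Function.update_of_ne hw]
    have hds : DifferentiableAt ℂ g₂ s := by
      have hV : ball (0 : ℂ) R ∩ {z | z ∉ S} ∈ 𝓝 s :=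
        inter_mem (isOpen_ball.mem_nhds hsR) (S.finite_toSet.isClosed.isOpen_compl.mem_nhds hsS)
      refine (Complex.differentiableOn_update_limUnder_of_isLittleO hV ?_ ?_).differentiableAt hV
      · rintro z ⟨⟨hz1, hz2⟩, hz3⟩
        refine (hd₁ z (ball_subset_closedBall hz1) ?_).differentiableWithinAt
        simp only [Finset.mem_insert, not_or]
        exact ⟨hz3, hz2⟩
      · have hlim : Tendsto (fun z => (z - s) • (g₁ z - g₁ s)) (𝓝[≠] s) (𝓝 0) := by
          have h0 : Tendsto (fun z : ℂ => z - s) (𝓝[≠] s) (𝓝 0) :=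
            (Continuous.tendsto' (by fun_prop) _ _ (by simp)).mono_left nhdsWithin_le_nhds
          have h1 := ((hρ s (by simp)).sub (tendsto_const_nhds (x := ρ s))).sub
            (h0.smul (tendsto_const_nhds (x := g₁ s)))
          simp only [sub_self, zero_smul] at h1
          refine h1.congr' ?_
          filter_upwards [self_mem_nhdsWithin] with z hz
          have hzs : z - s ≠ 0 := sub_ne_zero.2 hz
          simp only [hg₁, smul_sub, smul_smul, mul_inv_cancel₀ hzs, one_smul]
        refine Asymptotics.isLittleO_iff.2 fun ε hε => ?_
        filter_upwards [self_mem_nhdsWithin, hlim.norm.eventually (gt_mem_nhds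
          (by simpa using hε : ‖(0 : E)‖ < ε))] with z hz hz'
        have hzs : 0 < ‖z - s‖ := norm_pos_iff.2 (sub_ne_zero.2 hz)
        rw [norm_smul] at hz'
        rw [norm_inv, ← div_eq_mul_inv, le_div_iff₀ hzs, mul_comm]
        exact hz'.le
    have key := ih (fun t ht => hS t (by simp [ht])) g₂ ?_ ?_
    · have hEq : (∮ z in C(0, R), g₂ z) = (∮ z in C(0, R), g z) -
          ∮ z in C(0, R), (z - s)⁻¹ • ρ s := by
        rw [← circleIntegral.integral_sub]
        · refine circleIntegral.integral_congr hR.le fun z hz => ?_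
          have : z ≠ s := fun h => hsph z hz (by simp [h])
          exact (hne z this).eq_of_nhds
        · refine ContinuousOn.circleIntegrable hR.le fun z hz => ?_
          exact (hg z (sphere_subset_closedBall hz) (hsph z hz)).continuousAt.continuousWithinAt
        · refine ContinuousOn.circleIntegrable hR.le fun z hz => ?_
          have hzs : z - s ≠ 0 := sub_ne_zero.2 fun h => hsph z hz (by simp [h])
          exact (((continuousAt_id.sub continuousAt_const).inv₀ hzs).smul
            continuousAt_const).continuousWithinAt
      rw [circleIntegral.integral_smul_const, circleIntegral.integral_sub_inv_of_mem_ball hsR,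
        key, eq_comm, sub_eq_iff_eq_add] at hEq
      rw [hEq, Finset.sum_insert hsS, smul_add, add_comm]
    · intro z hz hzS
      rcases eq_or_ne z s with rfl | hzs
      · exact hds
      · exact (hd₁ z hz (by simp [hzs, hzS])).congr_of_eventuallyEq (hne z hzs)
    · intro t ht
      have hts : t ≠ s := fun h => hsS (h ▸ ht)
      have h0 : Tendsto (fun z : ℂ => (z - t) • ((z - s)⁻¹ • ρ s)) (𝓝[≠] t) (𝓝 0) := by
        have : ContinuousAt (fun z : ℂ => (z - t) • ((z - s)⁻¹ • ρ s)) t :=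
          (continuousAt_id.sub continuousAt_const).smul
            (((continuousAt_id.sub continuousAt_const).inv₀ (sub_ne_zero.2 hts)).smul
              continuousAt_const)
        simpa [ContinuousAt] using this.mono_left nhdsWithin_le_nhds
      have h1 := (hρ t (by simp [ht])).sub h0
      rw [sub_zero] at h1
      refine h1.congr' ?_
      filter_upwards [(hne t hts).filter_mono nhdsWithin_le_nhds] with z hz
      simp only [hz, hg₁, smul_sub]

/-- The residues of `c⁻¹ • h` at the simple zeros of `c`. -/
theorem circleIntegral_inv_smul_eq_sum [CompleteSpace E] {R : ℝ} (hR : 0 < R)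
    {c : ℂ → ℂ} {h : ℂ → E} (hc : Differentiable ℂ c) (hh : Differentiable ℂ h) (S : Finset ℂ)
    (hS : ∀ s ∈ S, s ∈ Metric.ball (0 : ℂ) R ∧ c s = 0 ∧ deriv c s ≠ 0)
    (hS' : ∀ z ∈ Metric.closedBall (0 : ℂ) R, c z = 0 → z ∈ S) :
    (∮ z in C(0, R), (c z)⁻¹ • h z) =
      (2 * Real.pi * Complex.I : ℂ) • ∑ s ∈ S, (deriv c s)⁻¹ • h s := by
  refine circleIntegral_eq_sum_of_simple_poles hR (fun s => (deriv c s)⁻¹ • h s) S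
    (fun s hs => (hS s hs).1) _ ?_ ?_
  · intro z hz hzS
    exact ((hc z).inv fun h0 => hzS (hS' z hz h0)).smul (hh z)
  · intro s hs
    obtain ⟨-, h0, h1⟩ := hS s hs
    have hsl := ((hasDerivAt_iff_tendsto_slope.1 (hc s).hasDerivAt).inv₀ h1).smul
      ((hh s).continuousAt.tendsto.mono_left (nhdsWithin_le_nhds (s := {s}ᶜ)))
    refine hsl.congr fun z => ?_
    simp [slope_def_field, h0, smul_smul, div_eq_mul_inv]

/-! ### Growth off the real axis -/

/-- **Phragmén–Lindelöf** for functions of exponential type that are bounded on the real line. -/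
theorem IsEntireOfExpType.norm_le {σ : ℝ} {F : ℂ → E} (hF : IsEntireOfExpType σ F)
    {K : ℝ} (hK : ∀ t : ℝ, ‖F t‖ ≤ K) (z : ℂ) : ‖F z‖ ≤ K * Real.exp (σ * |z.im|) := by
  -- The rotation `w ↦ w * I` carries the right half-plane to the upper one. The lower half-plane
  -- follows by applying this to `F (-z)`.
  have half : ∀ G : ℂ → E, IsEntireOfExpType σ G → (∀ t : ℝ, ‖G t‖ ≤ K) →
      ∀ w : ℂ, 0 ≤ w.re → ‖G (w * Complex.I)‖ ≤ K * Real.exp (σ * w.re) := by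
    intro G hG hGK w hw
    -- The factor `exp (-τ w)` makes the function bounded on the positive axis and has modulus `1`
    -- on the imaginary axis. The loss `ε` disappears in the limit.
    have main : ∀ ε : ℝ, 0 < ε → ‖G (w * Complex.I)‖ ≤ K * Real.exp ((σ + ε) * w.re) := by
      intro ε hε
      obtain ⟨C, hC⟩ := hG.2 ε hε
      have hC0 : 0 ≤ C := by simpa using (norm_nonneg _).trans (hC 0)
      set τ := σ + ε
      have := PhragmenLindelof.right_half_plane_of_bounded_on_real (C := K)
        (f := fun w : ℂ => Complex.exp (-(τ : ℂ) * w) • G (w * Complex.I)) (z := w)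
        ?_ ?_ ?_ ?_ hw
      · simp only [norm_smul, Complex.norm_exp] at this
        have h2 : (-(τ : ℂ) * w).re = -(τ * w.re) := by simp
        rw [h2, Real.exp_neg, inv_mul_le_iff₀ (Real.exp_pos _)] at this
        linarith
      · refine Differentiable.diffContOnCl ?_
        exact (by fun_prop : Differentiable ℂ fun w : ℂ => Complex.exp (-(τ : ℂ) * w)).smul
          (hG.1.comp (by fun_prop))
      · refine ⟨1, by norm_num, 2 * |τ|, Asymptotics.IsBigO.of_bound C ?_⟩
        refine Eventually.of_forall fun z => ?_
        simp only [norm_smul, Complex.norm_exp, Real.rpow_one, Real.norm_eq_abs, Real.abs_exp]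
        have h1 := hC (z * Complex.I)
        rw [norm_mul, Complex.norm_I, mul_one] at h1
        have h2 : (-(τ : ℂ) * z).re ≤ |τ| * ‖z‖ :=
          (Complex.re_le_norm _).trans (by simp)
        have h3 : τ * ‖z‖ ≤ |τ| * ‖z‖ := by gcongr; exact le_abs_self τ
        calc Real.exp (-(τ : ℂ) * z).re * ‖G (z * Complex.I)‖
            ≤ Real.exp (|τ| * ‖z‖) * (C * Real.exp (|τ| * ‖z‖)) := by
              gcongr
              exact h1.trans (by gcongr)
          _ = C * Real.exp (2 * |τ| * ‖z‖) := by
              rw [mul_left_comm, ← Real.exp_add]; ring_nf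
      · refine ⟨C, ?_⟩
        rw [eventually_map]
        filter_upwards [eventually_ge_atTop 0] with x hx
        have h1 := hC (x * Complex.I)
        rw [norm_mul, Complex.norm_I, mul_one, Complex.norm_real, Real.norm_of_nonneg hx] at h1
        simp only [norm_smul, Complex.norm_exp]
        have h2 : (-(τ : ℂ) * x).re = -(τ * x) := by simp
        rw [h2, Real.exp_neg, inv_mul_le_iff₀ (Real.exp_pos _)]
        linarith
      · intro x
        simp only [norm_smul, Complex.norm_exp]
        have h2 : (-(τ : ℂ) * (x * Complex.I)).re = 0 := by simp
        have h3 : (x : ℂ) * Complex.I * Complex.I = ((-x : ℝ) : ℂ) := by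
          rw [mul_assoc, Complex.I_mul_I]; simp
        rw [h2, h3, Real.exp_zero, one_mul]
        exact hGK _
    have hlim : Tendsto (fun ε : ℝ => K * Real.exp ((σ + ε) * w.re)) (𝓝[>] 0)
        (𝓝 (K * Real.exp (σ * w.re))) :=
      (Continuous.tendsto' (by fun_prop) _ _ (by simp)).mono_left nhdsWithin_le_nhds
    exact ge_of_tendsto hlim (eventually_nhdsWithin_of_forall fun ε hε => main ε hε)
  rcases le_total 0 z.im with h | h
  · have := half F hF hK (-Complex.I * z) (by simpa using h)
    have h1 : -Complex.I * z * Complex.I = z := by linear_combination (-z) * Complex.I_mul_I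
    rw [h1] at this
    simpa [abs_of_nonneg h] using this
  · have := half (fun w => F (-w)) ⟨hF.1.comp differentiable_neg, fun ε hε => ?_⟩
      (fun t => by simpa using hK (-t)) (Complex.I * z) (by simpa using h)
    · have h1 : -(Complex.I * z * Complex.I) = z := by linear_combination (-z) * Complex.I_mul_I
      simp only [h1] at this
      simpa [abs_of_nonpos h] using this
    · obtain ⟨C, hC⟩ := hF.2 ε hε
      exact ⟨C, fun z => by simpa using hC (-z)⟩

/-! ### The contour integral -/

/-- Summing the residues of `F P / (z ^ (n + 1) c)`, where `P - c` vanishes to order `n + 1` at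
`0`. -/
theorem tendsto_sum_residues [CompleteSpace E] {F : ℂ → E} (hF : Differentiable ℂ F) {K : ℝ}
    (hK : ∀ z, ‖F z‖ ≤ K * Real.exp |z.im|) {n : ℕ} (hn : 1 ≤ n) {c P ψ : ℂ → ℂ}
    (hc : Differentiable ℂ c) (hψ : Differentiable ℂ ψ)
    (hP : ∀ z, P z = c z + z ^ (n + 1) * ψ z) {B : ℝ}
    (hB : ∀ z : ℂ, 1 ≤ ‖z‖ → ‖P z‖ ≤ B * ‖z‖ ^ (n - 1))
    {R : ℕ → ℝ} (hR1 : ∀ N, 1 ≤ R N) (hR : Tendsto R atTop atTop)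
    (hlow : ∀ N, ∀ z : ℂ, ‖z‖ = R N → Real.exp |z.im| ≤ 4 * ‖c z‖)
    {S : ℕ → Finset ℂ}
    (hS : ∀ N, ∀ s ∈ S N, s ∈ Metric.ball (0 : ℂ) (R N) ∧ c s = 0 ∧ deriv c s ≠ 0)
    (hS' : ∀ N, ∀ z ∈ Metric.closedBall (0 : ℂ) (R N), c z = 0 → z ∈ S N) :
    Tendsto (fun N => ∑ s ∈ S N, (deriv c s)⁻¹ • ψ s • F s) atTop
      (𝓝 (-((n.factorial : ℂ)⁻¹ • iteratedDeriv n F 0))) := by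
  have h2π : (2 * Real.pi * Complex.I : ℂ) ≠ 0 := Complex.two_pi_I_ne_zero
  have hK0 : 0 ≤ K := by simpa using (norm_nonneg _).trans (hK 0)
  have hB0 : 0 ≤ B := by simpa using (norm_nonneg _).trans (hB 1 (by simp))
  -- By `hP`, `P / (z^(n+1) c) = 1 / z^(n+1) + ψ / c`. The first term gives Cauchy's formula for the
  -- derivative; the second has only simple poles, so a zero of `c` at the origin needs no special
  -- treatment.
  have hId : ∀ N, (∮ z in C(0, R N), (c z)⁻¹ • (z ^ (n + 1))⁻¹ • P z • F z) =
      (2 * Real.pi * Complex.I : ℂ) • ((n.factorial : ℂ)⁻¹ • iteratedDeriv n F 0 +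
        ∑ s ∈ S N, (deriv c s)⁻¹ • ψ s • F s) := by
    intro N
    have hRp : 0 < R N := zero_lt_one.trans_le (hR1 N)
    have hz0 : ∀ z ∈ Metric.sphere (0 : ℂ) (R N), z ≠ 0 := fun z hz => by
      rw [mem_sphere_zero_iff_norm] at hz
      rw [← norm_pos_iff, hz]; exact hRp
    have hc0 : ∀ z ∈ Metric.sphere (0 : ℂ) (R N), c z ≠ 0 := fun z hz h0 => by
      rw [mem_sphere_zero_iff_norm] at hz
      have := hlow N z hz
      rw [h0, norm_zero, mul_zero] at this
      exact absurd this (not_le.2 (Real.exp_pos _))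
    have h1 : (∮ z in C(0, R N), (c z)⁻¹ • (z ^ (n + 1))⁻¹ • P z • F z) =
        ∮ z in C(0, R N), ((1 / (z - 0) ^ (n + 1)) • F z + (c z)⁻¹ • ψ z • F z) := by
      refine circleIntegral.integral_congr hRp.le fun z hz => ?_
      have hzn := pow_ne_zero (n + 1) (hz0 z hz)
      have hcz := hc0 z hz
      simp only [smul_smul, ← add_smul, hP, sub_zero]
      congr 1
      field_simp
    rw [h1, circleIntegral.integral_add, circleIntegral_inv_smul_eq_sum (h := fun z => ψ z • F z) hRp hc (hψ.smul hF) (S N)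
      (hS N) (hS' N), smul_add]
    · congr 1
      rw [DiffContOnCl.circleIntegral_one_div_sub_center_pow_smul hRp n hF.diffContOnCl,
        smul_smul, div_eq_mul_inv]
    · refine ContinuousOn.circleIntegrable hRp.le fun z hz => ?_
      simp only [sub_zero]
      exact ((continuousAt_const.div (continuousAt_id.pow _) (pow_ne_zero (n + 1)
        (hz0 z hz))).smul (hF z).continuousAt).continuousWithinAt
    · refine ContinuousOn.circleIntegrable hRp.le fun z hz => ?_
      exact (((hc z).continuousAt.inv₀ (hc0 z hz)).smul
        ((hψ z).continuousAt.smul (hF z).continuousAt)).continuousWithinAt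
  -- On the circle `‖F / c‖ ≤ 4 K` and `‖P‖ ≤ B R^(n-1)`, so the integrand is `O(R⁻²)` against a
  -- length `2πR`.
  have hbd : ∀ N, ‖∮ z in C(0, R N), (c z)⁻¹ • (z ^ (n + 1))⁻¹ • P z • F z‖ ≤
      2 * Real.pi * (4 * B * K) * (R N)⁻¹ := by
    intro N
    have hRp : 0 < R N := zero_lt_one.trans_le (hR1 N)
    have := circleIntegral.norm_integral_le_of_norm_le_const (c := 0) hRp.le
      (f := fun z => (c z)⁻¹ • (z ^ (n + 1))⁻¹ • P z • F z)
      (C := 4 * B * K * ((R N)⁻¹ * (R N)⁻¹)) fun z hz => ?_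
    · refine this.trans_eq ?_
      field_simp
    · rw [mem_sphere_zero_iff_norm] at hz
      have hl := hlow N z hz
      have hcp : 0 < ‖c z‖ := by linarith [Real.exp_pos |z.im|]
      have hPz := hB z (hz ▸ hR1 N)
      rw [hz] at hPz
      simp only [norm_smul, norm_inv, norm_pow, hz]
      have hFz : ‖F z‖ ≤ K * (4 * ‖c z‖) := (hK z).trans (by gcongr)
      calc ‖c z‖⁻¹ * ((R N ^ (n + 1))⁻¹ * (‖P z‖ * ‖F z‖))
          ≤ ‖c z‖⁻¹ * ((R N ^ (n + 1))⁻¹ * (B * R N ^ (n - 1) * (K * (4 * ‖c z‖)))) := by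
            gcongr
        _ = 4 * B * K * ((R N)⁻¹ * (R N)⁻¹) := by
            obtain ⟨k, rfl⟩ : ∃ k, n = k + 1 := ⟨n - 1, by omega⟩
            simp only [Nat.add_sub_cancel]
            field_simp
            ring
  have hlim : Tendsto (fun N => ∮ z in C(0, R N), (c z)⁻¹ • (z ^ (n + 1))⁻¹ • P z • F z) atTop
      (𝓝 0) := by
    refine squeeze_zero_norm hbd ?_
    simpa using (tendsto_inv_atTop_zero.comp hR).const_mul (2 * Real.pi * (4 * B * K))
  have h3 := (hlim.const_smul (2 * Real.pi * Complex.I : ℂ)⁻¹).sub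
    (tendsto_const_nhds (x := (n.factorial : ℂ)⁻¹ • iteratedDeriv n F 0))
  rw [smul_zero, zero_sub] at h3
  refine h3.congr fun N => ?_
  rw [hId, inv_smul_smul₀ h2π, add_sub_cancel_left]

/-! ### Taylor remainders of cosine and sine -/

open Nat in
/-- The Taylor polynomial with `m` terms of the cosine (`e = 0`) or the sine (`e = 1`). -/
def trigTaylor {𝕜 : Type*} [Field 𝕜] (m e : ℕ) (x : 𝕜) : 𝕜 :=
  ∑ j ∈ Finset.range m, (-1) ^ j * x ^ (2 * j + e) / ((2 * j + e)! : 𝕜)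

open Nat in
/-- The normalised Taylor remainder `∑ i, (-1) ^ (i + m) z ^ (2 i) / (2 i + n)!` of the cosine
(`n = 2 m`) or the sine (`n = 2 m + 1`). -/
def trigTail (m n : ℕ) (z : ℂ) : ℂ :=
  ∑' i : ℕ, (-1) ^ (i + m) * z ^ (2 * i) / ((2 * i + n)! : ℂ)

open Nat in
theorem norm_trigTail_term_le (m n i : ℕ) {z : ℂ} {R : ℝ} (hz : ‖z‖ ≤ R) :
    ‖(-1) ^ (i + m) * z ^ (2 * i) / ((2 * i + n)! : ℂ)‖ ≤ R ^ (2 * i) / (2 * i)! := by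
  have hR : 0 ≤ R := (norm_nonneg z).trans hz
  simp only [norm_div, norm_mul, norm_pow, norm_neg, norm_one, one_pow, one_mul,
    Complex.norm_natCast]
  gcongr
  omega

open Nat in
theorem summable_pow_two_mul_div_factorial (R : ℝ) :
    Summable fun i : ℕ => R ^ (2 * i) / (2 * i)! :=
  (Real.summable_pow_div_factorial R).comp_injective
    (mul_right_injective₀ (two_ne_zero : (2 : ℕ) ≠ 0))

theorem differentiable_trigTail (m n : ℕ) : Differentiable ℂ (trigTail m n) := by
  intro z
  have hz : Metric.ball (0 : ℂ) (‖z‖ + 1) ∈ 𝓝 z :=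
    Metric.isOpen_ball.mem_nhds (by simp)
  refine (Complex.differentiableOn_tsum_of_summable_norm
    (summable_pow_two_mul_div_factorial (‖z‖ + 1)) (fun i => ?_) Metric.isOpen_ball
    fun i w hw => norm_trigTail_term_le m n i ?_).differentiableAt hz
  · exact Differentiable.differentiableOn (by fun_prop)
  · rw [mem_ball_zero_iff] at hw
    exact hw.le

open Nat in
theorem eq_trigTaylor_add_of_hasSum {e m : ℕ} {z w : ℂ}
    (h : HasSum (fun j : ℕ => (-1) ^ j * z ^ (2 * j + e) / ((2 * j + e)! : ℂ)) w) :
    w = trigTaylor m e z + z ^ (2 * m + e) * trigTail m (2 * m + e) z := by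
  rw [← h.tsum_eq, ← h.summable.sum_add_tsum_nat_add m, trigTail, ← tsum_mul_left]
  refine congrArg₂ _ rfl (tsum_congr fun i => ?_)
  rw [show 2 * (i + m) + e = 2 * i + (2 * m + e) by ring, pow_add z]
  ring

theorem cos_eq_trigTaylor_add (m : ℕ) (z : ℂ) :
    Complex.cos z = trigTaylor m 0 z + z ^ (2 * m) * trigTail m (2 * m) z :=
  eq_trigTaylor_add_of_hasSum (e := 0) (Complex.hasSum_cos z)

theorem sin_eq_trigTaylor_add (m : ℕ) (z : ℂ) :
    Complex.sin z = trigTaylor m 1 z + z ^ (2 * m + 1) * trigTail m (2 * m + 1) z :=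
  eq_trigTaylor_add_of_hasSum (e := 1) (Complex.hasSum_sin z)

theorem trigTail_zero (m n : ℕ) : trigTail m n 0 = (-1) ^ m / (n.factorial : ℂ) := by
  rw [trigTail, tsum_eq_single 0]
  · simp
  · intro i hi
    simp [hi]

theorem trigTail_neg (m n : ℕ) (z : ℂ) : trigTail m n (-z) = trigTail m n z := by
  simp only [trigTail, (even_two_mul _).neg_pow]

theorem ofReal_trigTaylor (m e : ℕ) (x : ℝ) :
    ((trigTaylor m e x : ℝ) : ℂ) = trigTaylor m e (x : ℂ) := by
  simp [trigTaylor]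

theorem hasDerivAt_trigTaylor_one (m : ℕ) (x : ℝ) :
    HasDerivAt (trigTaylor m 1) (trigTaylor m 0 x) x := by
  unfold trigTaylor
  refine HasDerivAt.fun_sum fun j _ => ?_
  have := ((hasDerivAt_pow (2 * j + 1) x).const_mul ((-1) ^ j)).div_const
    ((2 * j + 1).factorial : ℝ)
  refine this.congr_deriv ?_
  rw [Nat.factorial_succ]
  have : ((2 * j).factorial : ℝ) ≠ 0 := by positivity
  push_cast
  simp only [add_zero]
  field_simp

theorem hasDerivAt_trigTaylor_zero (m : ℕ) (x : ℝ) :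
    HasDerivAt (trigTaylor (m + 1) 0) (-trigTaylor m 1 x) x := by
  unfold trigTaylor
  simp only [Finset.sum_range_succ' _ m]
  rw [← Finset.sum_neg_distrib]
  simp only [mul_zero, add_zero, pow_zero]
  refine (HasDerivAt.fun_sum fun j _ => ?_).add_const _
  have := ((hasDerivAt_pow (2 * (j + 1)) x).const_mul ((-1) ^ (j + 1))).div_const
    ((2 * (j + 1)).factorial : ℝ)
  refine this.congr_deriv ?_
  rw [show 2 * (j + 1) = 2 * j + 1 + 1 by ring, Nat.factorial_succ (2 * j + 1)]
  have : ((2 * j + 1).factorial : ℝ) ≠ 0 := by positivity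
  push_cast
  simp only [pow_succ (-1 : ℝ) j]
  field_simp

theorem nonneg_of_hasDerivAt_nonneg {f f' : ℝ → ℝ} (hf : ∀ x, HasDerivAt f (f' x) x)
    (h0 : f 0 = 0) (hf' : ∀ x, 0 ≤ x → 0 ≤ f' x) {x : ℝ} (hx : 0 ≤ x) : 0 ≤ f x := by
  have := monotoneOn_of_deriv_nonneg (convex_Ici (0 : ℝ))
    (fun x _ => (hf x).continuousAt.continuousWithinAt)
    (fun x _ => (hf x).differentiableAt.differentiableWithinAt) (fun x hx => by
      rw [interior_Ici] at hx
      rw [(hf x).deriv]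
      exact hf' x (le_of_lt hx))
  simpa [h0] using this (Set.self_mem_Ici) hx hx

/-- The Taylor remainders of the cosine and the sine at `0` have the sign of the first omitted
term. -/
theorem trigTaylor_remainder_nonneg (m : ℕ) :
    (∀ x : ℝ, 0 ≤ x → 0 ≤ (-1) ^ (m + 1) * (Real.cos x - trigTaylor (m + 1) 0 x)) ∧
      ∀ x : ℝ, 0 ≤ x → 0 ≤ (-1) ^ (m + 1) * (Real.sin x - trigTaylor (m + 1) 1 x) := by
  -- All remainders vanish at `0`, and each is, up to sign, the derivative of the next. The sign
  -- therefore propagates by integration from `cos x ≤ 1`.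
  have hsin : ∀ m : ℕ,
      (∀ x : ℝ, 0 ≤ x → 0 ≤ (-1) ^ m * (Real.cos x - trigTaylor m 0 x)) →
      ∀ x : ℝ, 0 ≤ x → 0 ≤ (-1) ^ m * (Real.sin x - trigTaylor m 1 x) := fun m h x hx =>
    nonneg_of_hasDerivAt_nonneg (f := fun x => (-1) ^ m * (Real.sin x - trigTaylor m 1 x))
      (fun x => ((Real.hasDerivAt_sin x).sub (hasDerivAt_trigTaylor_one m x)).const_mul _)
      (by simp [trigTaylor]) h hx
  induction m with
  | zero =>
    have h : ∀ x : ℝ, 0 ≤ x → 0 ≤ (-1) ^ (0 + 1) * (Real.cos x - trigTaylor (0 + 1) 0 x) := by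
      intro x _
      simpa [trigTaylor] using Real.cos_le_one x
    exact ⟨h, hsin _ h⟩
  | succ m ih =>
    have h : ∀ x : ℝ, 0 ≤ x →
        0 ≤ (-1) ^ (m + 1 + 1) * (Real.cos x - trigTaylor (m + 1 + 1) 0 x) := fun x hx =>
      nonneg_of_hasDerivAt_nonneg
        (f := fun x => (-1) ^ (m + 1 + 1) * (Real.cos x - trigTaylor (m + 1 + 1) 0 x))
        (f' := fun x => (-1) ^ (m + 1) * (Real.sin x - trigTaylor (m + 1) 1 x))
        (fun x => (((Real.hasDerivAt_cos x).sub
          (hasDerivAt_trigTaylor_zero (m + 1) x)).const_mul _).congr_deriv (by ring))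
        (by simp [trigTaylor, Finset.sum_range_succ']) ih.2 hx
    exact ⟨h, hsin _ h⟩

/-- For `x > 0` divide the signed remainder by a power of `x`; the tail is even, and its value at
`0` is explicit. -/
theorem exists_trigTail_eq {m e : ℕ} (he : e < 2) (x : ℝ) :
    ∃ y : ℝ, 0 ≤ y ∧ trigTail (m + 1) (2 * (m + 1) + e) x = ((-1) ^ (m + 1) * y : ℝ) := by
  have pos : ∀ x : ℝ, 0 < x →
      ∃ y : ℝ, 0 ≤ y ∧ trigTail (m + 1) (2 * (m + 1) + e) x = ((-1) ^ (m + 1) * y : ℝ) := by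
    intro x hx
    obtain ⟨c, hc, hc'⟩ : ∃ c : ℝ, 0 ≤ (-1) ^ (m + 1) * (c - trigTaylor (m + 1) e x) ∧
        (c : ℂ) = trigTaylor (m + 1) e (x : ℂ) +
          (x : ℂ) ^ (2 * (m + 1) + e) * trigTail (m + 1) (2 * (m + 1) + e) x := by
      interval_cases e
      · exact ⟨Real.cos x, (trigTaylor_remainder_nonneg m).1 x hx.le, by
          rw [Complex.ofReal_cos]; exact cos_eq_trigTaylor_add (m + 1) x⟩
      · exact ⟨Real.sin x, (trigTaylor_remainder_nonneg m).2 x hx.le, by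
          rw [Complex.ofReal_sin]; exact sin_eq_trigTaylor_add (m + 1) x⟩
    refine ⟨(-1) ^ (m + 1) * (c - trigTaylor (m + 1) e x) / x ^ (2 * (m + 1) + e),
      div_nonneg hc (by positivity), ?_⟩
    have hx' : (x : ℂ) ^ (2 * (m + 1) + e) ≠ 0 :=
      pow_ne_zero _ (Complex.ofReal_ne_zero.2 hx.ne')
    have hsq : ((-1) ^ (m + 1) * (-1) ^ (m + 1) : ℂ) = 1 := by
      rw [← mul_pow]; simp
    push_cast
    rw [ofReal_trigTaylor, hc', add_sub_cancel_left, ← mul_div_assoc, ← mul_assoc, hsq]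
    field_simp
  rcases lt_trichotomy x 0 with hx | rfl | hx
  · obtain ⟨y, hy, h⟩ := pos (-x) (by linarith)
    refine ⟨y, hy, ?_⟩
    rw [← h, Complex.ofReal_neg, trigTail_neg]
  · refine ⟨((2 * (m + 1) + e).factorial : ℝ)⁻¹, by positivity, ?_⟩
    rw [Complex.ofReal_zero, trigTail_zero]
    push_cast
    rw [div_eq_mul_inv]
  · exact pos x hx

theorem norm_trigTaylor_le (m e : ℕ) {z : ℂ} (hz : 1 ≤ ‖z‖) :
    ‖trigTaylor (m + 1) e z‖ ≤ (m + 1 : ℕ) * ‖z‖ ^ (2 * m + e) := by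
  unfold trigTaylor
  have h : ∀ j ∈ Finset.range (m + 1),
      ‖(-1) ^ j * z ^ (2 * j + e) / ((2 * j + e).factorial : ℂ)‖ ≤ ‖z‖ ^ (2 * m + e) := by
    intro j hj
    rw [Finset.mem_range] at hj
    simp only [norm_div, norm_mul, norm_pow, norm_neg, norm_one, one_pow, one_mul,
      Complex.norm_natCast]
    refine (div_le_self (by positivity) ?_).trans (pow_le_pow_right₀ hz (by omega))
    exact_mod_cast Nat.factorial_pos _
  simpa using norm_sum_le_of_le _ h

/-! ### Lower bounds for cosine and sine on circles -/

/-- Near the real axis `a`, the cosine or sine of the real part, suffices, since `e < 4 * 7 / 9`.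
Away from it, `exp |v| ≥ 2` gives `sinh |v| ≥ exp |v| / 4`. -/
theorem exp_abs_le_four_mul {x a v : ℝ} (hx : 0 ≤ x) (h : x ^ 2 = a ^ 2 + Real.sinh v ^ 2)
    (ha : |v| ≤ 1 → 7 / 9 ≤ |a|) : Real.exp |v| ≤ 4 * x := by
  rcases le_total |v| 1 with hv | hv
  · have h1 : |a| ≤ x := by
      rw [← abs_of_nonneg hx]
      exact sq_le_sq.1 (by nlinarith [sq_nonneg (Real.sinh v)])
    have h2 : Real.exp |v| ≤ Real.exp 1 := Real.exp_le_exp.2 hv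
    linarith [Real.exp_one_lt_d9, ha hv]
  · have h1 : |Real.sinh v| ≤ x := by
      rw [← abs_of_nonneg hx]
      exact sq_le_sq.1 (by nlinarith [sq_nonneg a])
    have h2 : |Real.sinh v| = Real.sinh |v| := Real.abs_sinh v
    rw [h2, Real.sinh_eq] at h1
    have h3 : Real.exp (-|v|) ≤ 1 := Real.exp_le_one_iff.2 (by linarith)
    have h4 : 2 ≤ Real.exp |v| := by linarith [Real.add_one_le_exp |v|]
    linarith

theorem norm_cos_sq (z : ℂ) : ‖Complex.cos z‖ ^ 2 = Real.cos z.re ^ 2 + Real.sinh z.im ^ 2 := by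
  rw [← Complex.normSq_eq_norm_sq, Complex.cos_eq, ← Complex.ofReal_cos, ← Complex.ofReal_sin,
    ← Complex.ofReal_cosh, ← Complex.ofReal_sinh, Complex.normSq_apply]
  simp only [Complex.sub_re, Complex.sub_im, Complex.mul_re, Complex.mul_im, Complex.ofReal_re,
    Complex.ofReal_im, Complex.I_re, Complex.I_im]
  have h1 := Real.cosh_sq z.im
  have h2 := Real.sin_sq_add_cos_sq z.re
  linear_combination Real.cos z.re ^ 2 * h1 + Real.sinh z.im ^ 2 * h2

theorem norm_sin_sq (z : ℂ) : ‖Complex.sin z‖ ^ 2 = Real.sin z.re ^ 2 + Real.sinh z.im ^ 2 := by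
  rw [← Complex.normSq_eq_norm_sq, Complex.sin_eq, ← Complex.ofReal_cos, ← Complex.ofReal_sin,
    ← Complex.ofReal_cosh, ← Complex.ofReal_sinh, Complex.normSq_apply]
  simp only [Complex.add_re, Complex.add_im, Complex.mul_re, Complex.mul_im, Complex.ofReal_re,
    Complex.ofReal_im, Complex.I_re, Complex.I_im]
  have h1 := Real.cosh_sq z.im
  have h2 := Real.sin_sq_add_cos_sq z.re
  linear_combination Real.sin z.re ^ 2 * h1 + Real.sinh z.im ^ 2 * h2

/-- With `x = Re z`, `‖z‖² - |x|² ≤ 1` and `‖z‖ + |x| ≥ 3/2` give `‖z‖ - |x| ≤ 2/3`, and `1 - (2/3)²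
/ 2 = 7/9`. -/
theorem seven_div_nine_le_cos_norm_sub {z : ℂ} (hz : 3 / 2 ≤ ‖z‖) (hv : |z.im| ≤ 1) :
    7 / 9 ≤ Real.cos (‖z‖ - |z.re|) := by
  have h0 : 0 ≤ ‖z‖ - |z.re| := sub_nonneg.2 (Complex.abs_re_le_norm z)
  have h1 : ‖z‖ ^ 2 = |z.re| ^ 2 + |z.im| ^ 2 := by
    rw [← Complex.normSq_eq_norm_sq, Complex.normSq_apply, sq_abs, sq_abs]; ring
  have h2 : ‖z‖ - |z.re| ≤ 2 / 3 := by
    nlinarith [abs_nonneg z.re, abs_nonneg z.im]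
  have h3 := Real.one_sub_sq_div_two_le_cos (x := ‖z‖ - |z.re|)
  nlinarith

/-- The radius is an extremal point of the cosine, so the addition formula reduces `|cos (Re z)|` to
`|cos (‖z‖ - |Re z|)|`. -/
theorem exp_abs_im_le_norm_cos {z : ℂ} (hz : 3 / 2 ≤ ‖z‖) (h : |Real.cos ‖z‖| = 1) :
    Real.exp |z.im| ≤ 4 * ‖Complex.cos z‖ := by
  refine exp_abs_le_four_mul (norm_nonneg _) (norm_cos_sq z) fun hv => ?_
  have h1 : Real.sin ‖z‖ = 0 := by
    have := Real.sin_sq_add_cos_sq ‖z‖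
    rw [← sq_abs (Real.cos _), h] at this
    simpa using this
  have h2 : Real.cos |z.re| = Real.cos ‖z‖ * Real.cos (‖z‖ - |z.re|) := by
    rw [show |z.re| = ‖z‖ - (‖z‖ - |z.re|) by ring, Real.cos_sub, h1]
    simp
  rw [← Real.cos_abs, h2, abs_mul, h, one_mul]
  exact (seven_div_nine_le_cos_norm_sub hz hv).trans (le_abs_self _)

theorem exp_abs_im_le_norm_sin {z : ℂ} (hz : 3 / 2 ≤ ‖z‖) (h : Real.cos ‖z‖ = 0) :
    Real.exp |z.im| ≤ 4 * ‖Complex.sin z‖ := by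
  refine exp_abs_le_four_mul (norm_nonneg _) (norm_sin_sq z) fun hv => ?_
  have h1 : |Real.sin ‖z‖| = 1 := by
    rcases Real.cos_eq_zero_iff_sin_eq.1 h with h | h <;> simp [h]
  have h2 : Real.sin |z.re| = Real.sin ‖z‖ * Real.cos (‖z‖ - |z.re|) := by
    rw [show |z.re| = ‖z‖ - (‖z‖ - |z.re|) by ring, Real.sin_sub, h]
    simp
  have h3 : |Real.sin z.re| = |Real.sin (|z.re|)| := by
    rcases abs_choice z.re with h | h <;> simp [h]
  rw [h3, h2, abs_mul, h1, one_mul]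
  exact (seven_div_nine_le_cos_norm_sub hz hv).trans (le_abs_self _)

/-! ### Nodes and weights -/

/-- The indices of the nodes of order `r` (with `σ = 1`) in a disc of radius `π (N + 1)` (`r` odd)
or `π (N + 1 / 2)` (`r` even). -/
def window (r N : ℕ) : Finset ℤ :=
  -- The half-open interval makes the half-integers `k - 1/2` symmetric about `0`.
  if Odd r then Finset.Ioc (-(N + 1 : ℤ)) (N + 1) else Finset.Icc (-(N : ℤ)) N

theorem tendsto_window (r : ℕ) : Tendsto (window r) atTop atTop := by
  refine tendsto_atTop_finset_of_monotone (fun M N h => ?_) fun k => ⟨k.natAbs, ?_⟩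
  · unfold window
    split_ifs
    · exact Finset.Ioc_subset_Ioc (by omega) (by omega)
    · exact Finset.Icc_subset_Icc (by omega) (by omega)
  · unfold window
    split_ifs
    · rw [Finset.mem_Ioc]; omega
    · rw [Finset.mem_Icc]; omega

theorem node_odd (σ : ℝ) (m : ℕ) (k : ℤ) :
    node σ (2 * m + 1) k = Real.pi / σ * ((k : ℝ) - 1 / 2) := by
  rw [node, if_pos ⟨m, rfl⟩]

theorem node_even (σ : ℝ) (m : ℕ) (k : ℤ) : node σ (2 * m) k = Real.pi * k / σ := by
  rw [node, if_neg (Nat.not_odd_iff_even.2 (even_two_mul m))]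

theorem node_eq_div (σ : ℝ) (r : ℕ) (k : ℤ) : node σ r k = node 1 r k / σ := by
  unfold node
  split_ifs <;> ring

theorem weight_eq_mul (σ : ℝ) (r : ℕ) (k : ℤ) : weight σ r k = σ ^ r * weight 1 r k := by
  unfold weight
  rw [div_pow, div_pow, one_pow]
  ring

/-- Where `c` vanishes, its remainder is minus its Taylor polynomial: this is the origin of the
finite sums in `coeffA` and `coeffB`. -/
theorem trigTail_of_zero {m e : ℕ} {c z : ℂ} (hz : z ≠ 0) (hc : c = 0)
    (h : c = trigTaylor m e z + z ^ (2 * m + e) * trigTail m (2 * m + e) z) :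
    trigTail m (2 * m + e) z = -(trigTaylor m e z / z ^ (2 * m + e)) := by
  have hz' := pow_ne_zero (2 * m + e) hz
  rw [hc] at h
  field_simp
  linear_combination -h

theorem cos_node_odd (m : ℕ) (k : ℤ) : Complex.cos (node 1 (2 * m + 1) k) = 0 := by
  rw [Complex.cos_eq_zero_iff]
  refine ⟨k - 1, ?_⟩
  rw [node_odd]
  push_cast
  ring

theorem sin_node_even (m : ℕ) (k : ℤ) : Complex.sin (node 1 (2 * m) k) = 0 := by
  rw [Complex.sin_eq_zero_iff]
  refine ⟨k, ?_⟩
  rw [node_even]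
  push_cast
  ring

/-- Puts the weight in residue form; order `2m + 1` uses `coeffA (m + 1)`, hence `m + 1` Taylor
terms. -/
theorem weight_one_odd (m : ℕ) (k : ℤ) :
    (weight 1 (2 * m + 1) k : ℂ) = ((2 * m + 1).factorial : ℂ) * (-1) ^ k *
      trigTail (m + 1) (2 * (m + 1)) (node 1 (2 * m + 1) k) := by
  have hk : (node 1 (2 * m + 1) k : ℂ) ≠ 0 := by
    rw [Complex.ofReal_ne_zero, node_odd]
    refine mul_ne_zero (by positivity) fun h => ?_
    have : (2 * k - 1 : ℤ) = (0 : ℤ) := by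
      have h' : (2 * k - 1 : ℝ) = 0 := by linarith
      exact_mod_cast h'
    omega
  have ht := trigTail_of_zero (e := 0) hk (cos_node_odd m k) (cos_eq_trigTaylor_add (m + 1) _)
  rw [add_zero] at ht
  rw [ht, ← ofReal_trigTaylor, weight, if_pos ⟨m, rfl⟩, coeffA, trigTaylor]
  have h1 : (2 * m + 1 + 1) / 2 = m + 1 := by omega
  have h2 : 2 * (m + 1) - 1 = 2 * m + 1 := by omega
  have h3 : node 1 (2 * m + 1) k = Real.pi * ((k : ℝ) - 1 / 2) := by rw [node_odd, div_one]
  rw [h3] at hk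
  have hx : ((k : ℝ) - 1 / 2) ≠ 0 := fun h => hk (by rw [h]; simp)
  rw [h1, h2, h3, zpow_add_one₀ (by norm_num)]
  have h4 : ∑ j ∈ Finset.range (m + 1), (-1 : ℝ) ^ j / ((2 * j).factorial : ℝ) *
      (Real.pi * ((k : ℝ) - 1 / 2)) ^ (2 * j) = ∑ j ∈ Finset.range (m + 1),
      (-1 : ℝ) ^ j * (Real.pi * ((k : ℝ) - 1 / 2)) ^ (2 * j + 0) / ((2 * j + 0).factorial : ℝ) :=
    Finset.sum_congr rfl fun j _ => by rw [add_zero]; ring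
  rw [h4]
  generalize ∑ j ∈ Finset.range (m + 1), (-1 : ℝ) ^ j * (Real.pi * ((k : ℝ) - 1 / 2)) ^ (2 * j + 0)
    / ((2 * j + 0).factorial : ℝ) = T
  have h5 : (1 / Real.pi) ^ (2 * m + 1) * ((-1 : ℝ) ^ k * -1 * (((2 * m + 1).factorial : ℝ) /
      (Real.pi * ((k : ℝ) - 1 / 2) ^ (2 * (m + 1))) * T)) = ((2 * m + 1).factorial : ℝ) *
      (-1) ^ k * -(T / (Real.pi * ((k : ℝ) - 1 / 2)) ^ (2 * (m + 1))) := by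
    rw [mul_pow, one_div, inv_pow, show 2 * (m + 1) = 2 * m + 1 + 1 by ring, pow_succ Real.pi]
    field_simp
    ring
  rw [h5]
  push_cast
  ring

/-- In residue form the exceptional coefficient at `k = 0` is no exception: it is the value of the
tail at `0`. -/
theorem weight_one_even (m : ℕ) (k : ℤ) :
    (weight 1 (2 * (m + 1)) k : ℂ) = ((2 * (m + 1)).factorial : ℂ) * (-1) ^ k *
      trigTail (m + 1) (2 * (m + 1) + 1) (node 1 (2 * (m + 1)) k) := by
  have h1 : 2 * (m + 1) / 2 = m + 1 := by omega
  rw [weight, if_neg (Nat.not_odd_iff_even.2 (even_two_mul _)), coeffB, h1]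
  rcases eq_or_ne k 0 with rfl | hk
  · rw [if_pos rfl, node_even, Int.cast_zero, mul_zero, zero_div, Complex.ofReal_zero,
      trigTail_zero, Nat.factorial_succ]
    have hf : ((2 * (m + 1)).factorial : ℂ) ≠ 0 := Nat.cast_ne_zero.2 (Nat.factorial_ne_zero _)
    have hm : (2 * ((m : ℂ) + 1) + 1) ≠ 0 := by exact_mod_cast Nat.succ_ne_zero (2 * (m + 1))
    have hπ : (Real.pi : ℂ) ≠ 0 := Complex.ofReal_ne_zero.2 Real.pi_ne_zero
    push_cast
    rw [one_div, inv_pow]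
    simp only [zpow_one, zpow_zero]
    field_simp
    ring
  · have h3 : node 1 (2 * (m + 1)) k = Real.pi * (k : ℝ) := by rw [node_even, div_one]
    have hkR : (k : ℝ) ≠ 0 := Int.cast_ne_zero.2 hk
    have hk' : (node 1 (2 * (m + 1)) k : ℂ) ≠ 0 := by
      rw [Complex.ofReal_ne_zero, h3]
      exact mul_ne_zero Real.pi_ne_zero hkR
    rw [trigTail_of_zero hk' (sin_node_even (m + 1) k) (sin_eq_trigTaylor_add (m + 1) _),
      ← ofReal_trigTaylor, trigTaylor, if_neg hk, h3, zpow_add_one₀ (by norm_num)]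
    generalize ∑ j ∈ Finset.range (m + 1), (-1 : ℝ) ^ j * (Real.pi * (k : ℝ)) ^ (2 * j + 1)
      / ((2 * j + 1).factorial : ℝ) = T
    have h5 : (1 / Real.pi) ^ (2 * (m + 1)) * ((-1 : ℝ) ^ k * -1 *
        (((2 * (m + 1)).factorial : ℝ) / (Real.pi * (k : ℝ) ^ (2 * (m + 1) + 1)) * T)) =
        ((2 * (m + 1)).factorial : ℝ) * (-1) ^ k *
          -(T / (Real.pi * (k : ℝ)) ^ (2 * (m + 1) + 1)) := by
      rw [mul_pow, one_div, inv_pow, pow_succ Real.pi]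
      field_simp
    rw [h5]
    push_cast
    ring

theorem deriv_cos_node (m : ℕ) (k : ℤ) :
    deriv Complex.cos (node 1 (2 * m + 1) k : ℂ) = (-1) ^ k := by
  rw [Complex.deriv_cos, ← Complex.ofReal_sin, node_odd, div_one,
    show Real.pi * ((k : ℝ) - 1 / 2) = k * Real.pi - Real.pi / 2 by ring,
    Real.sin_sub_pi_div_two, Real.cos_int_mul_pi]
  push_cast
  ring

theorem deriv_sin_node (m : ℕ) (k : ℤ) :
    deriv Complex.sin (node 1 (2 * m) k : ℂ) = (-1) ^ k := by
  rw [Complex.deriv_sin, ← Complex.ofReal_cos, node_even, div_one, mul_comm,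
    Real.cos_int_mul_pi]
  push_cast
  rfl

theorem node_injective (r : ℕ) : Function.Injective fun k : ℤ => (node 1 r k : ℂ) := by
  intro k l h
  have h' := Complex.ofReal_injective h
  have hπ := Real.pi_ne_zero
  unfold node at h'
  split_ifs at h'
  · simpa [hπ] using h'
  · simpa [hπ] using h'

/-! ### The Boas formula for type `1` -/

/-- Treats both parities at once: `e = 0` with the cosine, `e = 1` with the sine. Here `ψ` is minus
the tail, and multiplying the residue sum by `-r!` produces the weights. -/
theorem tendsto_sum_window_of_taylor [CompleteSpace E] {m e : ℕ} {c : ℂ → ℂ}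
    (hc : Differentiable ℂ c)
    (hT : ∀ z, c z = trigTaylor (m + 1) e z +
      z ^ (2 * (m + 1) + e) * trigTail (m + 1) (2 * (m + 1) + e) z)
    (hz : ∀ z, c z = 0 ↔ ∃ k : ℤ, z = node 1 (2 * m + 1 + e) k)
    (hd : ∀ k : ℤ, deriv c (node 1 (2 * m + 1 + e) k) = (-1) ^ k)
    (hw : ∀ k : ℤ, (weight 1 (2 * m + 1 + e) k : ℂ) = ((2 * m + 1 + e).factorial : ℂ) * (-1) ^ k *
      trigTail (m + 1) (2 * (m + 1) + e) (node 1 (2 * m + 1 + e) k))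
    {R : ℕ → ℝ} (hR1 : ∀ N, 1 ≤ R N) (hR : Tendsto R atTop atTop)
    (hlow : ∀ N, ∀ z : ℂ, ‖z‖ = R N → Real.exp |z.im| ≤ 4 * ‖c z‖)
    (hwin : ∀ N k, k ∈ window (2 * m + 1 + e) N ↔ |node 1 (2 * m + 1 + e) k| ≤ R N)
    {F : ℂ → E} (hF : Differentiable ℂ F) {K : ℝ} (hK : ∀ z, ‖F z‖ ≤ K * Real.exp |z.im|) :
    Tendsto (fun N => ∑ k ∈ window (2 * m + 1 + e) N,
      (weight 1 (2 * m + 1 + e) k : ℂ) • F (node 1 (2 * m + 1 + e) k)) atTop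
      (𝓝 (iteratedDeriv (2 * m + 1 + e) F 0)) := by
  classical
  set r := 2 * m + 1 + e with hr
  have hexp : 2 * (m + 1) + e = r + 1 := by omega
  have hu : ∀ k : ℤ, ((-1 : ℂ) ^ k) ≠ 0 := fun k => zpow_ne_zero _ (by norm_num)
  have hinv : ∀ k : ℤ, ((-1 : ℂ) ^ k)⁻¹ = (-1) ^ k := fun k => by
    rw [← inv_zpow]; norm_num
  have main := tendsto_sum_residues hF hK (n := r) (by omega) hc (P := trigTaylor (m + 1) e)
    (ψ := fun z => -trigTail (m + 1) (2 * (m + 1) + e) z) (differentiable_trigTail _ _).neg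
    (fun z => by rw [hT, hexp]; ring) (B := ((m + 1 : ℕ) : ℝ))
    (fun z hz1 => (norm_trigTaylor_le m e hz1).trans_eq (by congr 2; omega)) hR1 hR hlow
    (S := fun N => (window r N).image fun k => (node 1 r k : ℂ)) ?_ ?_
  · have := main.const_smul (-(r.factorial : ℂ))
    rw [neg_smul_neg, smul_inv_smul₀ (Nat.cast_ne_zero.2 (Nat.factorial_ne_zero r))] at this
    refine this.congr fun N => ?_
    rw [Finset.sum_image fun k _ l _ h => node_injective r h, Finset.smul_sum]
    refine Finset.sum_congr rfl fun k _ => ?_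
    rw [hw, hd, hinv, smul_smul, smul_smul]
    congr 1
    ring
  · intro N s hs
    obtain ⟨k, hk, rfl⟩ := Finset.mem_image.1 hs
    have h0 := (hz (node 1 r k)).2 ⟨k, rfl⟩
    refine ⟨?_, h0, ?_⟩
    · rw [mem_ball_zero_iff, Complex.norm_real, Real.norm_eq_abs]
      -- No node lies on the circle, since `c` would vanish there against `hlow`.
      refine lt_of_le_of_ne ((hwin N k).1 hk) fun h => ?_
      have := hlow N (node 1 r k) (by rw [Complex.norm_real, Real.norm_eq_abs, h])
      rw [h0, norm_zero, mul_zero] at this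
      exact absurd this (not_le.2 (Real.exp_pos _))
    · simpa only [hd] using hu k
  · intro N z hzR h0
    obtain ⟨k, rfl⟩ := (hz z).1 h0
    rw [mem_closedBall_zero_iff, Complex.norm_real, Real.norm_eq_abs] at hzR
    exact Finset.mem_image.2 ⟨k, (hwin N k).2 hzR, rfl⟩

theorem mem_window_odd (m N : ℕ) (k : ℤ) :
    k ∈ window (2 * m + 1) N ↔ |node 1 (2 * m + 1) k| ≤ Real.pi * (N + 1) := by
  rw [window, if_pos ⟨m, rfl⟩, Finset.mem_Ioc, node_odd, div_one, abs_mul, abs_of_pos Real.pi_pos,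
    mul_le_mul_iff_right₀ Real.pi_pos, abs_le]
  -- Doubling clears the half-integers and leaves integer inequalities for `omega`.
  have h1 : (-((N : ℝ) + 1) ≤ k - 1 / 2) ↔ -(2 * ((N : ℤ) + 1)) ≤ 2 * k - 1 := by
    rw [← Int.cast_le (R := ℝ)]
    push_cast
    constructor <;> intro h <;> linarith
  have h2 : ((k : ℝ) - 1 / 2 ≤ N + 1) ↔ 2 * k - 1 ≤ 2 * ((N : ℤ) + 1) := by
    rw [← Int.cast_le (R := ℝ)]
    push_cast
    constructor <;> intro h <;> linarith
  rw [h1, h2]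
  omega

theorem mem_window_even (m N : ℕ) (k : ℤ) :
    k ∈ window (2 * m) N ↔ |node 1 (2 * m) k| ≤ Real.pi * (N + 1 / 2) := by
  rw [window, if_neg (Nat.not_odd_iff_even.2 (even_two_mul m)), Finset.mem_Icc, node_even, div_one,
    abs_mul, abs_of_pos Real.pi_pos, mul_le_mul_iff_right₀ Real.pi_pos, abs_le]
  have h1 : (-((N : ℝ) + 1 / 2) ≤ k) ↔ -(2 * (N : ℤ) + 1) ≤ 2 * k := by
    rw [← Int.cast_le (R := ℝ)]
    push_cast
    constructor <;> intro h <;> linarith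
  have h2 : ((k : ℝ) ≤ N + 1 / 2) ↔ 2 * k ≤ 2 * (N : ℤ) + 1 := by
    rw [← Int.cast_le (R := ℝ)]
    push_cast
    constructor <;> intro h <;> linarith
  rw [h1, h2]
  omega

theorem tendsto_pi_mul_add (a : ℝ) :
    Tendsto (fun N : ℕ => Real.pi * ((N : ℝ) + a)) atTop atTop :=
  (tendsto_atTop_add_const_right _ _ tendsto_natCast_atTop_atTop).const_mul_atTop Real.pi_pos

/-- The Boas formula at the origin for functions of exponential type `1`, with the series summed
symmetrically. -/
theorem tendsto_sum_window [CompleteSpace E] {r : ℕ} (hr : 1 ≤ r)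
    {F : ℂ → E} (hF : Differentiable ℂ F) {K : ℝ} (hK : ∀ z, ‖F z‖ ≤ K * Real.exp |z.im|) :
    Tendsto (fun N => ∑ k ∈ window r N, (weight 1 r k : ℂ) • F (node 1 r k)) atTop
      (𝓝 (iteratedDeriv r F 0)) := by
  have hπ := Real.pi_gt_three
  obtain ⟨m, hm | hm⟩ : ∃ m : ℕ, r = 2 * m + 1 + 0 ∨ r = 2 * m + 1 + 1 :=
    ⟨(r - 1) / 2, by omega⟩
  · subst hm
    have hpos : ∀ N : ℕ, 3 / 2 ≤ Real.pi * ((N : ℝ) + 1) := fun N => by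
      nlinarith [Nat.cast_nonneg (α := ℝ) N]
    refine tendsto_sum_window_of_taylor Complex.differentiable_cos
      (cos_eq_trigTaylor_add (m + 1)) (fun z => ⟨fun h => ?_, ?_⟩) (deriv_cos_node m)
      (weight_one_odd m) (fun N => by linarith [hpos N]) (tendsto_pi_mul_add 1)
      (fun N z hz => exp_abs_im_le_norm_cos (hz ▸ hpos N) ?_) (mem_window_odd m) hF hK
    · obtain ⟨k, hk⟩ := Complex.cos_eq_zero_iff.1 h
      refine ⟨k + 1, ?_⟩
      rw [add_zero, node_odd, hk]
      push_cast
      ring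
    · rintro ⟨k, rfl⟩
      exact cos_node_odd m k
    · rw [hz, mul_comm, show ((N : ℝ) + 1) = ((N + 1 : ℤ) : ℝ) by push_cast; rfl]
      exact Real.abs_cos_int_mul_pi _
  · obtain rfl : r = 2 * (m + 1) := by omega
    have hpos : ∀ N : ℕ, 3 / 2 ≤ Real.pi * ((N : ℝ) + 1 / 2) := fun N => by
      nlinarith [Nat.cast_nonneg (α := ℝ) N]
    refine tendsto_sum_window_of_taylor (e := 1) Complex.differentiable_sin
      (sin_eq_trigTaylor_add (m + 1)) (fun z => ⟨fun h => ?_, ?_⟩) (deriv_sin_node (m + 1))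
      (weight_one_even m) (fun N => by linarith [hpos N]) (tendsto_pi_mul_add (1 / 2))
      (fun N z hz => exp_abs_im_le_norm_sin (hz ▸ hpos N) ?_) (mem_window_even (m + 1)) hF hK
    · obtain ⟨k, hk⟩ := Complex.sin_eq_zero_iff.1 h
      refine ⟨k, ?_⟩
      rw [show 2 * m + 1 + 1 = 2 * (m + 1) by ring, node_even, hk]
      push_cast
      ring
    · rintro ⟨k, rfl⟩
      exact sin_node_even (m + 1) k
    · rw [hz, Real.cos_eq_zero_iff]
      exact ⟨N, by push_cast; ring⟩

/-! ### Total mass of the weights -/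

/-- In residue form the only signs are `(-1)^k` and that of the tail, which is the same at every
node. -/
theorem weight_one_mul_sign {r : ℕ} (hr : 1 ≤ r) (k : ℤ) :
    weight 1 r k * (-1) ^ k * (-1) ^ ((r + 1) / 2) = |weight 1 r k| := by
  have key : ∀ {m e : ℕ} (_ : e < 2) (_ : r = 2 * m + 1 + e)
      (_ : (weight 1 r k : ℂ) = (r.factorial : ℂ) * (-1) ^ k *
        trigTail (m + 1) (2 * (m + 1) + e) (node 1 r k)),
      weight 1 r k * (-1) ^ k * (-1) ^ ((r + 1) / 2) = |weight 1 r k| := by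
    intro m e he hr hw
    obtain ⟨y, hy, h⟩ := exists_trigTail_eq (m := m) he (node 1 r k)
    have hw' : weight 1 r k = r.factorial * (-1) ^ k * ((-1) ^ (m + 1) * y) := by
      rw [h] at hw
      refine Complex.ofReal_injective (hw.trans ?_)
      push_cast
      rfl
    have h1 : (r + 1) / 2 = m + 1 := by omega
    have h2 : ((-1 : ℝ) ^ k) * (-1) ^ k = 1 := by
      rw [← mul_zpow]; norm_num
    have h3 : ((-1 : ℝ) ^ (m + 1)) * (-1) ^ (m + 1) = 1 := by
      rw [← mul_pow]; norm_num
    rw [h1, hw']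
    simp only [abs_mul, abs_pow, abs_zpow, abs_neg, abs_one, one_pow, one_zpow, one_mul, mul_one,
      abs_of_nonneg hy, Nat.abs_cast]
    linear_combination (r.factorial : ℝ) * y * (h2 * ((-1 : ℝ) ^ (m + 1)) * (-1) ^ (m + 1)) +
      (r.factorial : ℝ) * y * h3
  obtain ⟨m, hm | hm⟩ : ∃ m : ℕ, r = 2 * m + 1 + 0 ∨ r = 2 * m + 1 + 1 :=
    ⟨(r - 1) / 2, by omega⟩
  · refine key (by norm_num) hm ?_
    subst hm
    exact weight_one_odd m k
  · refine key (e := 1) (by norm_num) hm ?_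
    obtain rfl : r = 2 * (m + 1) := by omega
    exact weight_one_even m k

/-- An extremal function for the Boas formula. -/
theorem exists_extremal {r : ℕ} (hr : 1 ≤ r) : ∃ F : ℂ → ℂ, Differentiable ℂ F ∧
    (∀ z, ‖F z‖ ≤ 1 * Real.exp |z.im|) ∧ (∀ k : ℤ, F (node 1 r k) = (-1) ^ k) ∧
    iteratedDeriv r F 0 = (-1) ^ ((r + 1) / 2) := by
  have hexp : ∀ z : ℂ, ‖Complex.exp (Complex.I * z)‖ ≤ Real.exp |z.im| := fun z => by
    rw [Complex.norm_exp]
    refine Real.exp_le_exp.2 ?_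
    simpa using neg_le_abs z.im
  have hdiff : Differentiable ℂ fun z => Complex.exp (Complex.I * z) := by fun_prop
  have hper : ∀ k : ℤ, Complex.exp (Complex.I * (k * Real.pi)) = (-1) ^ k := fun k => by
    rw [show Complex.I * (k * Real.pi) = k * (Real.pi * Complex.I) by ring, Complex.exp_int_mul,
      Complex.exp_pi_mul_I]
  rcases Nat.even_or_odd' r with ⟨m, rfl | rfl⟩
  · refine ⟨fun z => Complex.exp (Complex.I * z), hdiff, fun z => by simpa using hexp z,
      fun k => ?_, ?_⟩
    · rw [node_even, ← hper]
      push_cast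
      ring_nf
    · rw [iteratedDeriv_cexp_const_mul, show (2 * m + 1) / 2 = m by omega]
      simp [pow_mul]
  -- The factor `I` cancels the `exp (-iπ/2)` coming from the half-integer shift of the nodes.
  · refine ⟨fun z => Complex.I * Complex.exp (Complex.I * z), hdiff.const_mul _,
      fun z => by simpa using hexp z, fun k => ?_, ?_⟩
    · have h1 : Complex.I * (node 1 (2 * m + 1) k : ℂ) =
          Complex.I * (k * Real.pi) - Real.pi / 2 * Complex.I := by
        rw [node_odd]
        push_cast
        ring
      simp only [h1]
      rw [Complex.exp_sub, hper, Complex.exp_pi_div_two_mul_I]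
      field_simp
    · rw [iteratedDeriv_const_mul_field, iteratedDeriv_cexp_const_mul,
        show (2 * m + 1 + 1) / 2 = m + 1 by omega]
      simp only [mul_zero, Complex.exp_zero, mul_one]
      rw [← pow_succ', show 2 * m + 1 + 1 = 2 * (m + 1) by ring, pow_mul, Complex.I_sq]

/-- For the extremal function every term of the symmetric sums is `|weight|` up to one common sign,
so these sums converge to `1`; positivity turns this into unconditional convergence. -/
theorem hasSum_abs_weight_one {r : ℕ} (hr : 1 ≤ r) : HasSum (fun k => |weight 1 r k|) 1 := by
  have hlim : Tendsto (fun N => ∑ k ∈ window r N, |weight 1 r k|) atTop (𝓝 1) := by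
    obtain ⟨F, hF, hK, hFn, hFd⟩ := exists_extremal hr
    have := ((tendsto_sum_window hr hF hK).mul_const ((-1 : ℂ) ^ ((r + 1) / 2)))
    rw [hFd, ← mul_pow, neg_one_mul, neg_neg, one_pow] at this
    refine tendsto_ofReal_iff.mp (?_ : Tendsto
      (fun N => ((∑ k ∈ window r N, |weight 1 r k| : ℝ) : ℂ)) atTop (𝓝 ((1 : ℝ) : ℂ)))
    rw [Complex.ofReal_one]
    refine this.congr fun N => ?_
    rw [Finset.sum_mul]
    push_cast
    refine Finset.sum_congr rfl fun k _ => ?_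
    rw [← weight_one_mul_sign hr k, hFn]
    push_cast
    rw [smul_eq_mul]
  have hsum : Summable fun k => |weight 1 r k| := by
    -- Any constant above the limit `1` works: a finite set lies in some late window.
    refine summable_of_sum_le (c := 2) (fun k => abs_nonneg _) fun u => ?_
    obtain ⟨N, hN1, hN2⟩ := (((tendsto_window r).eventually_ge_atTop u).and
      (hlim.eventually_le_const (by norm_num : (1 : ℝ) < 2))).exists
    exact (Finset.sum_le_sum_of_subset_of_nonneg hN1 fun _ _ _ => abs_nonneg _).trans hN2
  have h := hsum.hasSum
  rwa [tendsto_nhds_unique (h.comp (tendsto_window r)) hlim] at h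

/-- The weights of the Boas formula of order `r` have total mass `σ ^ r`. -/
theorem hasSum_abs_weight {σ : ℝ} (hσ : 0 < σ) {r : ℕ} (hr : 1 ≤ r) :
    HasSum (fun k => |weight σ r k|) (σ ^ r) := by
  have := (hasSum_abs_weight_one hr).mul_left (σ ^ r)
  rw [mul_one] at this
  simpa only [weight_eq_mul σ, abs_mul, abs_of_pos (pow_pos hσ r)] using this

theorem summable_norm_weight_smul {σ : ℝ} (hσ : 0 < σ) {r : ℕ} (hr : 1 ≤ r) {u : ℤ → E} {K : ℝ}
    (hu : ∀ k, ‖u k‖ ≤ K) : Summable fun k => ‖weight σ r k • u k‖ := by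
  refine Summable.of_nonneg_of_le (fun k => norm_nonneg _) (fun k => ?_)
    ((hasSum_abs_weight hσ hr).summable.mul_right K)
  rw [norm_smul, Real.norm_eq_abs]
  gcongr
  exact hu k

theorem norm_tsum_weight_smul_le {σ : ℝ} (hσ : 0 < σ) {r : ℕ} (hr : 1 ≤ r) {u : ℤ → E} {K : ℝ}
    (hu : ∀ k, ‖u k‖ ≤ K) : ‖∑' k, weight σ r k • u k‖ ≤ σ ^ r * K := by
  refine tsum_of_norm_bounded ((hasSum_abs_weight hσ hr).mul_right K) fun k => ?_
  rw [norm_smul, Real.norm_eq_abs]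
  gcongr
  exact hu k

/-- The Boas sampling formula for entire functions of exponential type `σ` that are bounded on the
real line. -/
theorem IsEntireOfExpType.hasSum_iteratedDeriv [CompleteSpace E] {σ : ℝ} (hσ : 0 < σ) {F : ℂ → E}
    (hF : IsEntireOfExpType σ F) {K : ℝ} (hK : ∀ t : ℝ, ‖F t‖ ≤ K) {r : ℕ} (hr : 1 ≤ r) (t : ℝ) :
    HasSum (fun k => weight σ r k • F (t + node σ r k : ℝ)) (iteratedDeriv r F t) := by
  have hσ' : (σ : ℂ) ≠ 0 := Complex.ofReal_ne_zero.2 hσ.ne'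
  -- Translation by `t` and scaling reduce to type `1` at the origin. Absolute summability then
  -- upgrades the symmetric limit to a `HasSum`.
  set G : ℂ → E := fun z => F (t + (σ : ℂ)⁻¹ * z) with hG
  have hGd : Differentiable ℂ G := hF.1.comp (by fun_prop)
  have hGK : ∀ z, ‖G z‖ ≤ K * Real.exp |z.im| := fun z => by
    refine (hF.norm_le hK _).trans_eq ?_
    rw [← Complex.ofReal_inv, Complex.add_im, Complex.ofReal_im, zero_add, Complex.im_ofReal_mul,
      abs_mul, abs_of_pos (inv_pos.2 hσ), mul_inv_cancel_left₀ hσ.ne']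
  have hGi : iteratedDeriv r G 0 = ((σ : ℂ)⁻¹) ^ r • iteratedDeriv r F t := by
    have h1 : ContDiff ℂ r fun z => F (t + z) := (hF.1.comp (by fun_prop)).contDiff
    have h2 : iteratedDeriv r G 0 = _ :=
      congrFun (iteratedDeriv_comp_const_smul h1 ((σ : ℂ)⁻¹)) 0
    rw [h2, iteratedDeriv_comp_const_add]
    simp
  have hlim := ((tendsto_sum_window hr hGd hGK).const_smul ((σ : ℂ) ^ r))
  rw [hGi, smul_smul, ← mul_pow, mul_inv_cancel₀ hσ', one_pow, one_smul] at hlim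
  have hsum : Summable fun k => weight σ r k • F (t + node σ r k : ℝ) :=
    (summable_norm_weight_smul hσ hr fun k => hK _).of_norm
  have h := hsum.hasSum
  rwa [tendsto_nhds_unique (h.comp (tendsto_window r)) (hlim.congr fun N => ?_)] at h
  rw [Function.comp_apply, Finset.smul_sum]
  refine Finset.sum_congr rfl fun k _ => ?_
  dsimp only [hG]
  rw [weight_eq_mul σ, node_eq_div σ, ← Complex.coe_smul, smul_smul]
  push_cast
  rw [div_eq_inv_mul]

/-! ### Generator, powers and orbits -/

theorem generator_isGeneratorValue (U : ℝ → E →L[ℂ] E) (x : (generator U).domain) :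
    IsGeneratorValue U x (generator U x) :=
  Classical.choose_spec x.2

theorem mem_generator_domain {U : ℝ → E →L[ℂ] E} {x y : E} (h : IsGeneratorValue U x y) :
    ∃ hx : x ∈ (generator U).domain, generator U ⟨x, hx⟩ = y :=
  ⟨⟨y, h⟩, (generator_isGeneratorValue U ⟨x, ⟨y, h⟩⟩).unique h⟩

theorem mem_opPow_zero (D : E →ₗ.[ℂ] E) (x : E) :
    ∃ h : x ∈ (opPow D 0).domain, opPow D 0 ⟨x, h⟩ = x :=
  ⟨trivial, rfl⟩

theorem mem_opPow_succ {D : E →ₗ.[ℂ] E} {k : ℕ} {x y : E} :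
    (∃ h : x ∈ (opPow D (k + 1)).domain, opPow D (k + 1) ⟨x, h⟩ = y) ↔
      ∃ h : x ∈ (opPow D k).domain, ∃ h' : opPow D k ⟨x, h⟩ ∈ D.domain,
        D ⟨opPow D k ⟨x, h⟩, h'⟩ = y := by
  constructor
  · rintro ⟨h, rfl⟩
    obtain ⟨h1, -⟩ := id h
    obtain ⟨⟨z, hz⟩, hz', rfl⟩ := Submodule.mem_map.1 h1
    exact ⟨hz, hz', rfl⟩
  · rintro ⟨h, h', rfl⟩
    exact ⟨⟨Submodule.mem_map.2 ⟨⟨x, h⟩, h', rfl⟩, h⟩, rfl⟩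

theorem IsC0Group.apply_add {U : ℝ → E →L[ℂ] E} (hU : IsC0Group U) (s t : ℝ) (x : E) :
    U (s + t) x = U s (U t x) := by
  rw [hU.map_add]; rfl

theorem IsC0Group.apply_zero {U : ℝ → E →L[ℂ] E} (hU : IsC0Group U) (x : E) : U 0 x = x := by
  rw [hU.map_zero]; rfl

theorem IsC0Group.isGeneratorValue_iff {U : ℝ → E →L[ℂ] E} (hU : IsC0Group U) {x y : E} :
    IsGeneratorValue U x y ↔ HasDerivAt (fun t => U t x) y 0 := by
  simp only [hasDerivAt_iff_tendsto_slope_zero, zero_add, hU.apply_zero, IsGeneratorValue]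

/-- Since `U s x = U t (U (s - t) x)`, the bounded operator `U t` transports the derivative from `0`
to `t`. -/
theorem IsC0Group.hasDerivAt {U : ℝ → E →L[ℂ] E} (hU : IsC0Group U) {x y : E}
    (h : IsGeneratorValue U x y) (t : ℝ) : HasDerivAt (fun s => U s x) (U t y) t := by
  have h1 : HasDerivAt (fun s => U s x) y (t - t) := by
    rw [sub_self]; exact hU.isGeneratorValue_iff.1 h
  have h2 : HasDerivAt (fun s => U (s - t) x) y t := by
    simpa using h1.comp_sub_const t t
  have h3 := ((U t).restrictScalars ℝ).hasFDerivAt.comp_hasDerivAt t h2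
  refine h3.congr_of_eventuallyEq (Eventually.of_forall fun s => ?_)
  simp [← hU.apply_add]

/-- The derivatives at `0` of an entire extension of an orbit are the powers of the generator. -/
theorem IsC0Group.opPow_eq_iteratedDeriv {U : ℝ → E →L[ℂ] E} [CompleteSpace E]
    (hU : IsC0Group U) {F : ℂ → E} (hF : Differentiable ℂ F) {f : E}
    (hFU : ∀ t : ℝ, F t = U t f) (k : ℕ) :
    (∃ h : f ∈ (opPow (generator U) k).domain,
      opPow (generator U) k ⟨f, h⟩ = iteratedDeriv k F 0) ∧
      ∀ t : ℝ, U t (iteratedDeriv k F 0) = iteratedDeriv k F t := by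
  have hd : ∀ (k : ℕ) (t : ℝ),
      HasDerivAt (fun s : ℝ => iteratedDeriv k F s) (iteratedDeriv (k + 1) F t) t := by
    intro k t
    have h1 : ContDiff ℂ ⊤ F := hF.contDiff
    have h2 := ((h1.differentiable_iteratedDeriv k
      (WithTop.coe_lt_top _)) (t : ℂ)).hasDerivAt
    rw [← iteratedDeriv_succ] at h2
    simpa [Function.comp_def] using h2.scomp t Complex.ofRealCLM.hasDerivAt
  -- The orbit of `F^(k)(0)` is `F^(k)` on the real line. Differentiating at `0` gives the next
  -- power of the generator; differentiating at `t` gives the next orbit.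
  induction k with
  | zero =>
    have h0 : F 0 = f := by simpa [hU.apply_zero] using hFU 0
    simp only [iteratedDeriv_zero, h0]
    exact ⟨mem_opPow_zero _ f, fun t => (hFU t).symm⟩
  | succ k ih =>
    obtain ⟨⟨h, hk⟩, ht⟩ := ih
    have hg : IsGeneratorValue U (iteratedDeriv k F 0) (iteratedDeriv (k + 1) F 0) := by
      rw [hU.isGeneratorValue_iff]
      simpa [← ht] using hd k 0
    refine ⟨mem_opPow_succ.2 ⟨h, ?_⟩, fun t => ?_⟩
    · rw [hk]
      exact mem_generator_domain hg
    · exact (hU.hasDerivAt hg t).unique ((hd k t).congr_of_eventuallyEq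
        (Eventually.of_forall fun s => ht s))

/-- Taylor's formula for an orbit. -/
theorem IsC0Group.norm_sub_sum_le {U : ℝ → E →L[ℂ] E} (hU : IsC0Group U) {M : ℝ}
    (hM : ∀ t, ‖U t‖ ≤ M) {y : ℕ → E} (hy : ∀ k, IsGeneratorValue U (y k) (y (k + 1)))
    (t : ℝ) (n : ℕ) :
    ‖(∑ j ∈ Finset.range (n + 1), (t ^ j / j.factorial) • y j) - U t (y 0)‖ ≤
      |t| ^ n / n.factorial * (M * ‖y (n + 1)‖) * |t| := by
  have hM0 : 0 ≤ M := (norm_nonneg _).trans (hM 0)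
  have hd : ∀ (k : ℕ) (s : ℝ), HasDerivAt (fun s => U (t - s) (y k)) (-U (t - s) (y (k + 1))) s :=
    fun k s => by
      simpa [Function.comp_def] using (hU.hasDerivAt (hy k) (t - s)).scomp s ((hasDerivAt_id s).const_sub t)
  -- This function of `s` runs from `U t (y 0)` at `0` to the Taylor polynomial at `t`, and its
  -- derivative telescopes to one term; the mean value inequality finishes.
  have hφ : ∀ (n : ℕ) (s : ℝ), HasDerivAt
      (fun s : ℝ => ∑ j ∈ Finset.range (n + 1), (s ^ j / (j.factorial : ℝ)) • U (t - s) (y j))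
      (-((s ^ n / n.factorial) • U (t - s) (y (n + 1)))) s := by
    intro n s
    induction n with
    | zero => simpa using hd 0 s
    | succ n ih =>
      simp only [Finset.sum_range_succ _ (n + 1)]
      have h1 : HasDerivAt (fun s : ℝ => s ^ (n + 1) / ((n + 1).factorial : ℝ))
          (s ^ n / n.factorial) s := by
        refine ((hasDerivAt_pow (n + 1) s).div_const _).congr_deriv ?_
        rw [Nat.factorial_succ]
        have : (n.factorial : ℝ) ≠ 0 := by positivity
        push_cast
        field_simp
      refine (ih.add (h1.smul (hd (n + 1) s))).congr_deriv ?_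
      rw [smul_neg]
      abel
  have := Convex.norm_image_sub_le_of_norm_hasDerivWithin_le (𝕜 := ℝ)
    (f := fun s : ℝ => ∑ j ∈ Finset.range (n + 1), (s ^ j / (j.factorial : ℝ)) • U (t - s) (y j))
    (s := Set.uIcc 0 t) (x := 0) (y := t) (fun s _ => (hφ n s).hasDerivWithinAt)
    (C := |t| ^ n / n.factorial * (M * ‖y (n + 1)‖)) (fun s hs => ?_) (convex_uIcc 0 t)
    Set.left_mem_uIcc Set.right_mem_uIcc
  · have h0 : ∑ j ∈ Finset.range (n + 1), ((0 : ℝ) ^ j / j.factorial) • U (t - 0) (y j) =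
        U t (y 0) := by
      rw [Finset.sum_eq_single 0 (fun j _ hj => by simp [hj]) (by simp)]
      simp
    rw [h0] at this
    simpa only [sub_self, hU.apply_zero, sub_zero, Real.norm_eq_abs] using this
  · have hs' : |s| ≤ |t| := by
      simpa using Set.abs_sub_left_of_mem_uIcc hs
    rw [norm_neg, norm_smul, norm_div, norm_pow, Real.norm_eq_abs, Real.norm_eq_abs, Nat.abs_cast]
    gcongr
    exact ((U (t - s)).le_opNorm _).trans (by gcongr; exact hM _)

/-- The extension is the exponential series, dominated by `C exp (σ ‖z‖)`; on the real line the
Taylor remainder of the orbit tends to `0`. -/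
theorem orbitExtends_of_exponentialSpace [CompleteSpace E] {U : ℝ → E →L[ℂ] E}
    (hU : IsC0Group U) {M : ℝ} (hM : ∀ t, ‖U t‖ ≤ M) {σ : ℝ} {f : E}
    (hf : f ∈ exponentialSpace (generator U) σ) : OrbitExtends U σ f := by
  obtain ⟨C, hC, h⟩ := hf
  choose hmem hle using h
  set y : ℕ → E := fun k => opPow (generator U) k ⟨f, hmem k⟩ with hydef
  have hy0 : y 0 = f := rfl
  have hy : ∀ k, IsGeneratorValue U (y k) (y (k + 1)) := fun k => by
    obtain ⟨h1, h2, h3⟩ := mem_opPow_succ.1 ⟨hmem (k + 1), rfl⟩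
    have := generator_isGeneratorValue U ⟨_, h2⟩
    rwa [h3] at this
  have hterm : ∀ (k : ℕ) (z : ℂ) (R : ℝ), ‖z‖ ≤ R →
      ‖(z ^ k / (k.factorial : ℂ)) • y k‖ ≤ C * ((σ * R) ^ k / k.factorial) := by
    intro k z R hz
    rw [norm_smul, norm_div, norm_pow, Complex.norm_natCast]
    calc ‖z‖ ^ k / k.factorial * ‖y k‖ ≤ R ^ k / k.factorial * (C * σ ^ k) := by
          have hR : 0 ≤ R := (norm_nonneg z).trans hz
          gcongr
          exact hle k
      _ = C * ((σ * R) ^ k / k.factorial) := by rw [mul_pow]; ring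
  have hsum : ∀ R : ℝ, HasSum (fun k : ℕ => C * ((σ * R) ^ k / k.factorial))
      (C * Real.exp (σ * R)) := fun R => by
    rw [Real.exp_eq_exp_ℝ]
    exact (NormedSpace.expSeries_div_hasSum_exp (σ * R)).mul_left C
  set F : ℂ → E := fun z => ∑' k : ℕ, (z ^ k / (k.factorial : ℂ)) • y k with hF
  have hFU : ∀ t : ℝ, F t = U t f := by
    intro t
    have h1 : Summable fun k : ℕ => ((t : ℂ) ^ k / (k.factorial : ℂ)) • y k :=
      Summable.of_norm_bounded (hsum ‖(t : ℂ)‖).summable fun k => hterm k _ _ le_rfl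
    have h2 : Tendsto (fun n : ℕ => ∑ j ∈ Finset.range (n + 1), (t ^ j / (j.factorial : ℝ)) • y j)
        atTop (𝓝 (F t)) := by
      refine ((tendsto_add_atTop_iff_nat 1).2 h1.hasSum.tendsto_sum_nat).congr fun n => ?_
      refine Finset.sum_congr rfl fun j _ => ?_
      rw [← Complex.coe_smul]
      push_cast
      rfl
    refine tendsto_nhds_unique h2 (tendsto_iff_norm_sub_tendsto_zero.2 ?_)
    have h3 : Tendsto (fun n : ℕ => (σ * |t|) ^ n / n.factorial * (M * C * σ * |t|)) atTop
        (𝓝 0) := by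
      simpa using (FloorSemiring.tendsto_pow_div_factorial_atTop (σ * |t|)).mul_const
        (M * C * σ * |t|)
    refine squeeze_zero (fun n => norm_nonneg _) (fun n => ?_) h3
    have hM0 : 0 ≤ M := (norm_nonneg _).trans (hM 0)
    refine (hU.norm_sub_sum_le hM hy t n).trans ?_
    calc |t| ^ n / n.factorial * (M * ‖y (n + 1)‖) * |t|
        ≤ |t| ^ n / n.factorial * (M * (C * σ ^ (n + 1))) * |t| := by
          gcongr
          exact hle (n + 1)
      _ = (σ * |t|) ^ n / n.factorial * (M * C * σ * |t|) := by rw [mul_pow]; ring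
  refine ⟨F, ⟨fun z => ?_, fun ε hε => ⟨C, fun z => ?_⟩⟩, hFU, M * ‖f‖, fun t => ?_⟩
  · refine (Complex.differentiableOn_tsum_of_summable_norm (U := Metric.ball 0 (‖z‖ + 1))
      (hsum (‖z‖ + 1)).summable (fun k => Differentiable.differentiableOn (by fun_prop))
      Metric.isOpen_ball fun k w hw => hterm k w _ ?_).differentiableAt
        (Metric.isOpen_ball.mem_nhds (by simp))
    rw [mem_ball_zero_iff] at hw
    exact hw.le
  · refine (tsum_of_norm_bounded (hsum ‖z‖) fun k => hterm k z _ le_rfl).trans ?_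
    gcongr
    linarith
  · rw [hFU]
    exact ((U t).le_opNorm f).trans (by gcongr; exact hM t)

/-! ### The remaining implications -/

theorem samplingFormulas_of_orbitExtends [CompleteSpace E] {U : ℝ → E →L[ℂ] E}
    (hU : IsC0Group U) {σ : ℝ} (hσ : 0 < σ) {f : E} (hf : OrbitExtends U σ f) :
    SamplingFormulas U (generator U) σ f := by
  obtain ⟨F, hF, hFU, K, hK⟩ := hf
  intro r hr
  obtain ⟨⟨h, hval⟩, ht⟩ := hU.opPow_eq_iteratedDeriv hF.1 hFU r
  refine ⟨h, fun t => ?_⟩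
  rw [hval, ht]
  simpa only [hFU] using hF.hasSum_iteratedDeriv hσ hK hr t

theorem boasFormulas_of_samplingFormulas {U : ℝ → E →L[ℂ] E} (hU : IsC0Group U)
    {D : E →ₗ.[ℂ] E} {σ : ℝ} {f : E} (hf : SamplingFormulas U D σ f) : BoasFormulas U D σ f := by
  intro r hr
  obtain ⟨h, hs⟩ := hf r hr
  refine ⟨h, ?_⟩
  have := hs 0
  rw [hU.apply_zero] at this
  simpa only [zero_add, boasOp] using this.tsum_eq.symm

theorem norm_boasOp_le {U : ℝ → E →L[ℂ] E} {M : ℝ} (hM : ∀ t, ‖U t‖ ≤ M) {σ : ℝ} (hσ : 0 < σ)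
    {r : ℕ} (hr : 1 ≤ r) (f : E) : ‖boasOp U σ r f‖ ≤ σ ^ r * (M * ‖f‖) :=
  norm_tsum_weight_smul_le hσ hr fun _ => (U _).le_of_opNorm_le (hM _) f

/-- The mass `σ^k` leaves only the factor `M`, so `M = 1` yields Bernstein's inequality. `hM1`
serves `k = 0`, which the formulas do not cover. -/
theorem norm_opPow_le_of_boasFormulas {U : ℝ → E →L[ℂ] E} {M : ℝ} (hM : ∀ t, ‖U t‖ ≤ M)
    (hM1 : 1 ≤ M) {D : E →ₗ.[ℂ] E} {σ : ℝ} (hσ : 0 < σ) {f : E} (hf : BoasFormulas U D σ f)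
    (k : ℕ) : ∃ h : f ∈ (opPow D k).domain, ‖opPow D k ⟨f, h⟩‖ ≤ σ ^ k * (M * ‖f‖) := by
  rcases Nat.eq_zero_or_pos k with rfl | hk
  · obtain ⟨h, h'⟩ := mem_opPow_zero D f
    refine ⟨h, ?_⟩
    rw [h', pow_zero, one_mul]
    exact le_mul_of_one_le_left (norm_nonneg f) hM1
  · obtain ⟨h, h'⟩ := hf k hk
    refine ⟨h, ?_⟩
    rw [h']
    exact norm_boasOp_le hM hσ hk f

theorem exponentialSpace_of_boasFormulas {U : ℝ → E →L[ℂ] E} {M : ℝ} (hM : ∀ t, ‖U t‖ ≤ M)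
    {D : E →ₗ.[ℂ] E} {σ : ℝ} (hσ : 0 < σ) {f : E} (hf : BoasFormulas U D σ f) :
    f ∈ exponentialSpace D σ := by
  -- The summand `1` keeps the constant positive when `f = 0`.
  refine ⟨max M 1 * ‖f‖ + 1, by positivity, fun k => ?_⟩
  obtain ⟨h, h'⟩ := norm_opPow_le_of_boasFormulas (fun t => (hM t).trans (le_max_left M 1))
    (le_max_right M 1) hσ hf k
  refine ⟨h, h'.trans ?_⟩
  rw [mul_comm]
  gcongr
  linarith

theorem bernsteinSpace_subset_exponentialSpace (D : E →ₗ.[ℂ] E) {σ : ℝ} (hσ : 0 < σ) :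
    bernsteinSpace D σ ⊆ exponentialSpace D σ := by
  intro f hf
  refine ⟨‖f‖ + 1, by positivity, fun k => ?_⟩
  obtain ⟨h, h'⟩ := hf k
  refine ⟨h, h'.trans ?_⟩
  rw [mul_comm]
  gcongr
  linarith

theorem isBoundedLinearMap_boasOp [CompleteSpace E] {U : ℝ → E →L[ℂ] E} {M : ℝ}
    (hM : ∀ t, ‖U t‖ ≤ M) {σ : ℝ} (hσ : 0 < σ) {r : ℕ} (hr : 1 ≤ r) :
    IsBoundedLinearMap ℂ (boasOp U σ r) := by
  have hs : ∀ f, Summable fun k => weight σ r k • U (node σ r k) f := fun f =>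
    (summable_norm_weight_smul hσ hr fun _ => (U _).le_of_opNorm_le (hM _) f).of_norm
  refine IsLinearMap.with_bound ⟨fun f g => ?_, fun c f => ?_⟩ (σ ^ r * M) fun f => ?_
  · simp only [boasOp, _root_.map_add, smul_add]
    exact (hs f).tsum_add (hs g)
  · simp only [boasOp, map_smul, smul_comm _ c]
    exact tsum_const_smul'' c
  · rw [mul_assoc]
    exact norm_boasOp_le hM hσ hr f

end Boas

end

theorem theorem2 {E : Type*} [NormedAddCommGroup E] [NormedSpace ℂ E] [CompleteSpace E]
    (U : ℝ → E →L[ℂ] E) (hU : Boas.IsC0Group U)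
    (hbdd : ∃ M : ℝ, ∀ t : ℝ, ‖U t‖ ≤ M)
    (D : E →ₗ.[ℂ] E) (hD : D = Boas.generator U) (σ : ℝ) (hσ : 0 < σ) :
    -- the series defining the operators converge absolutely and define bounded operators
    (∀ r : ℕ, 1 ≤ r →
      (∀ g : E, Summable fun k : ℤ => ‖Boas.weight σ r k • U (Boas.node σ r k) g‖) ∧
        IsBoundedLinearMap ℂ (Boas.boasOp U σ r)) ∧
    -- bounded groups
    (∀ f : E, List.TFAE
      [f ∈ Boas.exponentialSpace D σ,
        Boas.OrbitExtends U σ f,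
        Boas.BoasFormulas U D σ f,
        Boas.SamplingFormulas U D σ f]) ∧
    -- groups of isometries
    ((∀ (t : ℝ) (g : E), ‖U t g‖ = ‖g‖) →
      ∀ f : E, List.TFAE
        [f ∈ Boas.bernsteinSpace D σ,
          Boas.OrbitExtends U σ f,
          Boas.BoasFormulas U D σ f,
          Boas.SamplingFormulas U D σ f]) := by
  obtain ⟨M, hM⟩ := hbdd
  subst hD
  refine ⟨fun r hr => ⟨fun g => Boas.summable_norm_weight_smul hσ hr fun k =>
    (U _).le_of_opNorm_le (hM _) g, Boas.isBoundedLinearMap_boasOp hM hσ hr⟩, fun f => ?_,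
    fun hiso f => ?_⟩
  · tfae_have 1 → 2 := Boas.orbitExtends_of_exponentialSpace hU hM
    tfae_have 2 → 4 := Boas.samplingFormulas_of_orbitExtends hU hσ
    tfae_have 4 → 3 := Boas.boasFormulas_of_samplingFormulas hU
    tfae_have 3 → 1 := Boas.exponentialSpace_of_boasFormulas hM hσ
    tfae_finish
  -- With bound `1` in place of `M`, the last implication lands in the Bernstein space itself.
  · have hM1 : ∀ t, ‖U t‖ ≤ 1 := fun t =>
      (U t).opNorm_le_bound zero_le_one fun g => by rw [hiso, one_mul]
    tfae_have 1 → 2 := fun h => Boas.orbitExtends_of_exponentialSpace hU hM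
      (Boas.bernsteinSpace_subset_exponentialSpace _ hσ h)
    tfae_have 2 → 4 := Boas.samplingFormulas_of_orbitExtends hU hσ
    tfae_have 4 → 3 := Boas.boasFormulas_of_samplingFormulas hU
    tfae_have 3 → 1 := fun h k => by
      simpa only [one_mul] using Boas.norm_opPow_le_of_boasFormulas hM1 le_rfl hσ h k
    tfae_finish
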